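/- Let $\mathbb F$ be an algebraically closed field and let $q\in\mathbb F$ be nonzero and not a root of unity. Let $\triangle_q$ be the universal Askey--Wilson algebra, i.e. the unital associative $\mathbb F$-algebra with generators $A,B,C$ and the relations that each of $$A+\frac{qBC-q^{-1}CB}{q^2-q^{-2}},\qquad B+\frac{qCA-q^{-1}AC}{q^2-q^{-2}},\qquad C+\frac{qAB-q^{-1}BA}{q^2-q^{-2}}$$ commutes with $A,B,C$. Let $\mathfrak H_q$ be the universal DAHA of type $(C_1^\vee,C_1)$, i.e. the unital associative $\mathbb F$-algebra with generators $t_i^{\pm1}$ $(i=0,1,2,3)$ and the relations $t_it_i^{-1}=t_i^{-1}t_i=1$, $t_i+t_i^{-1}$ is central $(i=0,1,2,3)$, and $t_0t_1t_2t_3=q^{-1}$. Every $\mathfrak H_q$-module is regarded as a $\triangle_q$-module via the algebra homomorphism $\triangle_q\to\mathfrak H_q$ with $A\mapsto t_1t_0+(t_1t_0)^{-1}$, $B\mapsto t_3t_0+(t_3t_0)^{-1}$, $C\mapsto t_2t_0+(t_2t_0)^{-1}$. Let $d\ge 0$ be an even integer and let $k_0,k_1,k_2,k_3\in\mathbb F$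 be nonzero with $k_0k_1k_2k_3=q^{-d-1}$. Let $O=O(k_0,k_1,k_2,k_3)$ be the $(d+1)$-dimensional $\mathfrak H_q$-module with basis $v_0,\dots,v_d$ on which, with the conventions $v_{-1}=v_{d+1}=0$, \begin{align*} t_0v_i&=k_0^{-1}q^{-i}(1-q^i)(1-k_0^2q^i)v_{i-1}+(k_0+k_0^{-1}-k_0^{-1}q^{-i})v_i &&(i\text{ even}),\\ t_0v_i&=k_0^{-1}q^{-i-1}(v_i-v_{i+1})&&(i\text{ odd}),\\ t_1v_i&=-k_1(1-q^i)(1-k_0^2q^i)v_{i-1}+k_1v_i+k_1^{-1}v_{i+1}&&(i\text{ even}),\\ t_1v_i&=k_1^{-1}v_i&&(i\text{ odd}),\\ t_2v_i&=k_2q^{d-i}(v_i-v_{i+1})&&(i\text{ even}),\\ t_2v_i&=-k_2(1-k_2^{-2}q^{i-d-1})(1-q^{d-i+1})v_{i-1}+(k_2+k_2^{-1}-k_2q^{d-i+1})v_i&&(i\text{ odd}),\\ t_3v_i&=k_3v_i&&(i\text{ even}),\\ t_3v_i&=-k_3^{-1}(1-k_2^{-2}q^{i-d-1})(1-q^{i-d-1})v_{i-1}+k_3^{-1}v_i+k_3v_{i+1}&&(i\text{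 odd}), \end{align*} and $t_i+t_i^{-1}$ acts as the scalar $k_i+k_i^{-1}$ for $i=0,1,2,3$. For $\theta\in\mathbb F$ put $O(\theta)=\{v\in O: t_0v=\theta v\}$, a $\triangle_q$-submodule of $O$, and let $O(k_0)'$ be the $\mathbb F$-subspace of $O$ spanned by the vectors $v_{i-1}+q^{-i}(v_i-v_{i-1})$ for $i=2,4,\dots,d$. **Theorem.** Assume that the $\mathfrak H_q$-module $O$ is irreducible. 1. If $d=0$, then the $\triangle_q$-module $O$ is irreducible. 2. If $d\ge2$ and $k_0^2=1$, then $O(k_0)'$ is a $\triangle_q$-submodule of $O$, it is contained in $O(k_0)$ with codimension $1$, and the $\triangle_q$-submodules of $O$ are exactly $\{0\}$, $O(k_0)'$, $O(k_0)$, $O$; they form the chain $\{0\}\subsetneq O(k_0)'\subsetneq O(k_0)\subsetneq O$. 3. If $d\ge2$ and $k_0^2\ne1$, then the $\triangle_q$-submodules of $O$ are exactly $\{0\}$, $O(k_0)$, $O(k_0^{-1})$, $O$; here $O(k_0)$ and $O(k_0^{-1})$ are nonzero and proper and $O=O(k_0)\oplus O(k_0^{-1})$, so that the lattice of submodules is a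 diamond. -/

import Mathlib

set_option linter.unusedSimpArgs false
set_option linter.unusedVariables false
set_option linter.unnecessarySeqFocus false

namespace AskeyWilson

noncomputable section

/-- `q` is nonzero and not a root of unity. -/
def NotRootOfUnity {F : Type*} [Field F] (q : F) : Prop :=
  q ≠ 0 ∧ ∀ n : ℕ, 0 < n → q ^ n ≠ 1

/-! ### The universal Askey--Wilson algebra -/

/-- The generators `A`, `B`, `C`. -/
inductive AWGen : Type
  | A
  | B
  | C

section AWPresentation

variable (F : Type*) [Field F] (q : F)

/-- For elements `x`, `y`, `z` of an `F`-algebra, the element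
`x + (q y z - q⁻¹ z y) / (q² - q⁻²)`. -/
def awElt {F R : Type*} [Field F] [Ring R] [Algebra F R] (q : F) (x y z : R) : R :=
  x + (q ^ 2 - q⁻¹ ^ 2)⁻¹ • (q • (y * z) - q⁻¹ • (z * y))

/-- The defining relations: each of `A + (qBC - q⁻¹CB)/(q² - q⁻²)`,
`B + (qCA - q⁻¹AC)/(q² - q⁻²)`, `C + (qAB - q⁻¹BA)/(q² - q⁻²)` commutes with the generators. -/
inductive AWRel : FreeAlgebra F AWGen → FreeAlgebra F AWGen → Prop
  | alpha (g : AWGen) : AWRel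
      (awElt q (FreeAlgebra.ι F AWGen.A) (FreeAlgebra.ι F AWGen.B) (FreeAlgebra.ι F AWGen.C)
        * FreeAlgebra.ι F g)
      (FreeAlgebra.ι F g *
        awElt q (FreeAlgebra.ι F AWGen.A) (FreeAlgebra.ι F AWGen.B) (FreeAlgebra.ι F AWGen.C))
  | beta (g : AWGen) : AWRel
      (awElt q (FreeAlgebra.ι F AWGen.B) (FreeAlgebra.ι F AWGen.C) (FreeAlgebra.ι F AWGen.A)
        * FreeAlgebra.ι F g)
      (FreeAlgebra.ι F g *
        awElt q (FreeAlgebra.ι F AWGen.B) (FreeAlgebra.ι F AWGen.C) (FreeAlgebra.ι F AWGen.A))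
  | gamma (g : AWGen) : AWRel
      (awElt q (FreeAlgebra.ι F AWGen.C) (FreeAlgebra.ι F AWGen.A) (FreeAlgebra.ι F AWGen.B)
        * FreeAlgebra.ι F g)
      (FreeAlgebra.ι F g *
        awElt q (FreeAlgebra.ι F AWGen.C) (FreeAlgebra.ι F AWGen.A) (FreeAlgebra.ι F AWGen.B))

/-- The universal Askey--Wilson algebra `△_q`. -/
def AW : Type _ := RingQuot (AWRel F q)

instance : Ring (AW F q) := inferInstanceAs (Ring (RingQuot (AWRel F q)))
instance : Algebra F (AW F q) := inferInstanceAs (Algebra F (RingQuot (AWRel F q)))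

/-- A generator of `△_q`. -/
def AW.gen (g : AWGen) : AW F q := RingQuot.mkAlgHom F (AWRel F q) (FreeAlgebra.ι F g)

end AWPresentation

/-! ### The universal DAHA of type `(C₁^∨, C₁)` -/

/-- The generators `t_i` and `t_i⁻¹`, `i = 0, 1, 2, 3`. -/
inductive DAHAGen : Type
  | t (i : Fin 4)
  | tInv (i : Fin 4)

section DAHAPresentation

variable (F : Type*) [Field F] (q : F)

/-- The defining relations: `t_i t_i⁻¹ = t_i⁻¹ t_i = 1`, `t_i + t_i⁻¹` is central,
`t_0 t_1 t_2 t_3 = q⁻¹`. -/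
inductive DAHARel : FreeAlgebra F DAHAGen → FreeAlgebra F DAHAGen → Prop
  | mul_inv (i : Fin 4) : DAHARel
      (FreeAlgebra.ι F (DAHAGen.t i) * FreeAlgebra.ι F (DAHAGen.tInv i)) 1
  | inv_mul (i : Fin 4) : DAHARel
      (FreeAlgebra.ι F (DAHAGen.tInv i) * FreeAlgebra.ι F (DAHAGen.t i)) 1
  | central (i : Fin 4) (x : FreeAlgebra F DAHAGen) : DAHARel
      ((FreeAlgebra.ι F (DAHAGen.t i) + FreeAlgebra.ι F (DAHAGen.tInv i)) * x)
      (x * (FreeAlgebra.ι F (DAHAGen.t i) + FreeAlgebra.ι F (DAHAGen.tInv i)))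
  | prod : DAHARel
      (FreeAlgebra.ι F (DAHAGen.t 0) * FreeAlgebra.ι F (DAHAGen.t 1) *
        FreeAlgebra.ι F (DAHAGen.t 2) * FreeAlgebra.ι F (DAHAGen.t 3))
      (algebraMap F (FreeAlgebra F DAHAGen) q⁻¹)

/-- The universal DAHA `𝔥_q` of type `(C₁^∨, C₁)`. -/
def DAHA : Type _ := RingQuot (DAHARel F q)

instance : Ring (DAHA F q) := inferInstanceAs (Ring (RingQuot (DAHARel F q)))
instance : Algebra F (DAHA F q) := inferInstanceAs (Algebra F (RingQuot (DAHARel F q)))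

/-- The generator `t_i`. -/
def DAHA.t (i : Fin 4) : DAHA F q :=
  RingQuot.mkAlgHom F (DAHARel F q) (FreeAlgebra.ι F (DAHAGen.t i))

/-- The generator `t_i⁻¹`. -/
def DAHA.tInv (i : Fin 4) : DAHA F q :=
  RingQuot.mkAlgHom F (DAHARel F q) (FreeAlgebra.ι F (DAHAGen.tInv i))

theorem DAHA.t_mul_tInv (i : Fin 4) : DAHA.t F q i * DAHA.tInv F q i = 1 := by
  have h := RingQuot.mkAlgHom_rel F (DAHARel.mul_inv (F := F) (q := q) i)
  rw [map_mul, map_one] at h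
  exact h

theorem DAHA.tInv_mul_t (i : Fin 4) : DAHA.tInv F q i * DAHA.t F q i = 1 := by
  have h := RingQuot.mkAlgHom_rel F (DAHARel.inv_mul (F := F) (q := q) i)
  rw [map_mul, map_one] at h
  exact h

theorem DAHA.t_prod :
    DAHA.t F q 0 * DAHA.t F q 1 * DAHA.t F q 2 * DAHA.t F q 3 = algebraMap F _ q⁻¹ := by
  have h := RingQuot.mkAlgHom_rel F (DAHARel.prod (F := F) (q := q))
  rw [map_mul, map_mul, map_mul, AlgHom.commutes] at h
  exact h

theorem DAHA.central (i : Fin 4) (x : DAHA F q) :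
    (DAHA.t F q i + DAHA.tInv F q i) * x = x * (DAHA.t F q i + DAHA.tInv F q i) := by
  obtain ⟨x, rfl⟩ := RingQuot.mkAlgHom_surjective F (DAHARel F q) x
  have h := RingQuot.mkAlgHom_rel F (DAHARel.central (F := F) (q := q) i x)
  rw [map_mul, map_mul, map_add] at h
  exact h

/-- The element `t_i t_0 + (t_i t_0)⁻¹`. -/
def DAHA.w (i : Fin 4) : DAHA F q :=
  DAHA.t F q i * DAHA.t F q 0 + DAHA.tInv F q 0 * DAHA.tInv F q i

/-- The images of the generators of `△_q`: `A ↦ t₁t₀ + (t₁t₀)⁻¹`, `B ↦ t₃t₀ + (t₃t₀)⁻¹`,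
`C ↦ t₂t₀ + (t₂t₀)⁻¹`. -/
def zetaGen : AWGen → DAHA F q
  | AWGen.A => DAHA.w F q 1
  | AWGen.B => DAHA.w F q 3
  | AWGen.C => DAHA.w F q 2

end DAHAPresentation

/-! Auxiliary identities used to construct the homomorphism from the universal Askey--Wilson
algebra to the universal DAHA. -/

section Identities

theorem zeta_aux_comm {K H : Type*} [CommRing K] [Ring H] [Module K H]
    [IsScalarTower K H H] [SMulCommClass K H H]
    (c0 c1 : K) (t0 t1 : H) (h0 : t0 * t0 = c0 • t0 - 1) :
    t0 * (t1 * t0 + (c0 • (1 : H) - t0) * (c1 • (1 : H) - t1)) =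
      (t1 * t0 + (c0 • (1 : H) - t0) * (c1 • (1 : H) - t1)) * t0 := by
  have h0' : ∀ x, t0 * (t0 * x) = c0 • (t0 * x) - x := fun x => by
    rw [← mul_assoc, h0, sub_mul, smul_mul_assoc, one_mul]
  simp only [mul_add, add_mul, mul_sub, sub_mul, smul_mul_assoc, mul_smul_comm, mul_assoc,
    mul_one, one_mul, h0, h0']
  module

set_option maxHeartbeats 1600000 in
theorem zeta_aux_alpha {K H : Type*} [CommRing K] [Ring H] [Module K H]
    [IsScalarTower K H H] [SMulCommClass K H H]
    (p q c0 c1 c2 c3 : K) (t0 t1 t2 t3 s0 s1 s2 s3 : H) (hpq : p * q = 1)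
    (h0 : t0 * t0 = c0 • t0 - 1)
    (h2 : t2 * t2 = c2 • t2 - 1) (h3 : t3 * t3 = c3 • t3 - 1)
    (hs0 : s0 = c0 • (1 : H) - t0)
    (hs2 : s2 = c2 • (1 : H) - t2) (hs3 : s3 = c3 • (1 : H) - t3)
    (ht1 : t1 = p • (s0 * s3 * s2)) (hs1 : s1 = q • (t2 * t3 * t0))
    (h1 : t1 + s1 - c1 • (1 : H) = 0) :
    (q ^ 2 - p ^ 2) • (t1 * t0 + s0 * s1) + (q • ((t3 * t0 + s0 * s3) * (t2 * t0 + s0 * s2))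
      - p • ((t2 * t0 + s0 * s2) * (t3 * t0 + s0 * s3))) =
      (q - p) • ((c3 * c2) • (1 : H) + c1 • (q • s0 + p • t0)) := by
  have h0' : ∀ x, t0 * (t0 * x) = c0 • (t0 * x) - x := fun x => by
    rw [← mul_assoc, h0, sub_mul, smul_mul_assoc, one_mul]
  have h2' : ∀ x, t2 * (t2 * x) = c2 • (t2 * x) - x := fun x => by
    rw [← mul_assoc, h2, sub_mul, smul_mul_assoc, one_mul]
  have h3' : ∀ x, t3 * (t3 * x) = c3 • (t3 * x) - x := fun x => by
    rw [← mul_assoc, h3, sub_mul, smul_mul_assoc, one_mul]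
  obtain ⟨R, hR⟩ : ∃ R, R = t1 + s1 - c1 • (1 : H) := ⟨_, rfl⟩
  have key : (q ^ 2 - p ^ 2) • (t1 * t0 + s0 * s1) + (q • ((t3 * t0 + s0 * s3) * (t2 * t0 + s0 * s2))
      - p • ((t2 * t0 + s0 * s2) * (t3 * t0 + s0 * s3))) -
      (q - p) • ((c3 * c2) • (1 : H) + c1 • (q • s0 + p • t0)) =
      (c0 * q ^ 2) • R - p ^ 2 • (R * t0) - q ^ 2 • (t0 * R) - (c0 * c2) • (R * t2)
        + c0 • (t2 * R * t2) + c2 • (R * t2 * t0) - t2 * R * t2 * t0 + c2 • (t0 * R * t2)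
        - t0 * t2 * R * t2 := by
    clear h1
    subst hR ht1 hs1 hs0 hs2 hs3
    simp only [mul_add, add_mul, mul_sub, sub_mul, smul_mul_assoc, mul_smul_comm, mul_assoc,
      mul_one, one_mul, h0, h0', h2, h2', h3, h3', smul_add, smul_sub, smul_smul, sub_smul,
      add_smul]
    match_scalars <;> grind
  rw [h1] at hR
  rw [← sub_eq_zero, key, hR]
  simp

set_option maxHeartbeats 1600000 in
theorem zeta_aux_beta {K H : Type*} [CommRing K] [Ring H] [Module K H]
    [IsScalarTower K H H] [SMulCommClass K H H]
    (p q c0 c1 c2 c3 : K) (t0 t1 t2 t3 s0 s1 s2 s3 : H) (hpq : p * q = 1)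
    (h0 : t0 * t0 = c0 • t0 - 1)
    (h2 : t2 * t2 = c2 • t2 - 1) (h3 : t3 * t3 = c3 • t3 - 1)
    (hs0 : s0 = c0 • (1 : H) - t0)
    (hs2 : s2 = c2 • (1 : H) - t2) (hs3 : s3 = c3 • (1 : H) - t3)
    (ht1 : t1 = p • (s0 * s3 * s2)) (hs1 : s1 = q • (t2 * t3 * t0))
    (h1 : t1 + s1 - c1 • (1 : H) = 0) :
    (q ^ 2 - p ^ 2) • (t3 * t0 + s0 * s3) + (q • ((t2 * t0 + s0 * s2) * (t1 * t0 + s0 * s1))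
      - p • ((t1 * t0 + s0 * s1) * (t2 * t0 + s0 * s2))) =
      (q - p) • ((c2 * c1) • (1 : H) + c3 • (q • s0 + p • t0)) := by
  have h0' : ∀ x, t0 * (t0 * x) = c0 • (t0 * x) - x := fun x => by
    rw [← mul_assoc, h0, sub_mul, smul_mul_assoc, one_mul]
  have h2' : ∀ x, t2 * (t2 * x) = c2 • (t2 * x) - x := fun x => by
    rw [← mul_assoc, h2, sub_mul, smul_mul_assoc, one_mul]
  have h3' : ∀ x, t3 * (t3 * x) = c3 • (t3 * x) - x := fun x => by
    rw [← mul_assoc, h3, sub_mul, smul_mul_assoc, one_mul]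
  obtain ⟨R, hR⟩ : ∃ R, R = t1 + s1 - c1 • (1 : H) := ⟨_, rfl⟩
  have key : (q ^ 2 - p ^ 2) • (t3 * t0 + s0 * s3) + (q • ((t2 * t0 + s0 * s2) * (t1 * t0 + s0 * s1))
      - p • ((t1 * t0 + s0 * s1) * (t2 * t0 + s0 * s2))) -
      (q - p) • ((c2 * c1) • (1 : H) + c3 • (q • s0 + p • t0)) =
      -((c2 * p) • R) + (c0 * c2 * q) • (R * t0) - (c2 * q) • (t0 * R * t0)
        - (c0 * q) • (t2 * R * t0) + (c0 * q) • (t2 * t0 * R) - p • (R * t0 * t2 * t0)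
        + p • (t0 * R * t2 * t0) + q • (t0 * t2 * R * t0) - q • (t0 * t2 * t0 * R) := by
    clear h1
    subst hR ht1 hs1 hs0 hs2 hs3
    simp only [mul_add, add_mul, mul_sub, sub_mul, smul_mul_assoc, mul_smul_comm, mul_assoc,
      mul_one, one_mul, h0, h0', h2, h2', h3, h3', smul_add, smul_sub, smul_smul, sub_smul,
      add_smul]
    match_scalars <;> grind
  rw [h1] at hR
  rw [← sub_eq_zero, key, hR]
  simp

set_option maxHeartbeats 1600000 in
theorem zeta_aux_gamma {K H : Type*} [CommRing K] [Ring H] [Module K H]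
    [IsScalarTower K H H] [SMulCommClass K H H]
    (p q c0 c1 c2 c3 : K) (t0 t1 t2 t3 s0 s1 s2 s3 : H) (hpq : p * q = 1)
    (h0 : t0 * t0 = c0 • t0 - 1)
    (h2 : t2 * t2 = c2 • t2 - 1) (h3 : t3 * t3 = c3 • t3 - 1)
    (hs0 : s0 = c0 • (1 : H) - t0)
    (hs2 : s2 = c2 • (1 : H) - t2) (hs3 : s3 = c3 • (1 : H) - t3)
    (ht1 : t1 = p • (s0 * s3 * s2)) (hs1 : s1 = q • (t2 * t3 * t0))
    (h1 : t1 + s1 - c1 • (1 : H) = 0) :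
    (q ^ 2 - p ^ 2) • (t2 * t0 + s0 * s2) + (q • ((t1 * t0 + s0 * s1) * (t3 * t0 + s0 * s3))
      - p • ((t3 * t0 + s0 * s3) * (t1 * t0 + s0 * s1))) =
      (q - p) • ((c1 * c3) • (1 : H) + c2 • (q • s0 + p • t0)) := by
  have h0' : ∀ x, t0 * (t0 * x) = c0 • (t0 * x) - x := fun x => by
    rw [← mul_assoc, h0, sub_mul, smul_mul_assoc, one_mul]
  have h2' : ∀ x, t2 * (t2 * x) = c2 • (t2 * x) - x := fun x => by
    rw [← mul_assoc, h2, sub_mul, smul_mul_assoc, one_mul]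
  have h3' : ∀ x, t3 * (t3 * x) = c3 • (t3 * x) - x := fun x => by
    rw [← mul_assoc, h3, sub_mul, smul_mul_assoc, one_mul]
  obtain ⟨R, hR⟩ : ∃ R, R = t1 + s1 - c1 • (1 : H) := ⟨_, rfl⟩
  have key : (q ^ 2 - p ^ 2) • (t2 * t0 + s0 * s2) + (q • ((t1 * t0 + s0 * s1) * (t3 * t0 + s0 * s3))
      - p • ((t3 * t0 + s0 * s3) * (t1 * t0 + s0 * s1))) -
      (q - p) • ((c1 * c3) • (1 : H) + c2 • (q • s0 + p • t0)) =
      (c3 * q) • R - (c0 * c3 * p) • (R * t0) + (c3 * p) • (t0 * R * t0)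
        + (c0 * p) • (t3 * R * t0) - (c0 * p) • (t3 * t0 * R) + q • (R * t0 * t3 * t0)
        - q • (t0 * R * t3 * t0) - p • (t0 * t3 * R * t0) + p • (t0 * t3 * t0 * R) := by
    clear h1
    subst hR ht1 hs1 hs0 hs2 hs3
    simp only [mul_add, add_mul, mul_sub, sub_mul, smul_mul_assoc, mul_smul_comm, mul_assoc,
      mul_one, one_mul, h0, h0', h2, h2', h3, h3', smul_add, smul_sub, smul_smul, sub_smul,
      add_smul]
    match_scalars <;> grind
  rw [h1] at hR
  rw [← sub_eq_zero, key, hR]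
  simp

end Identities

/-! ### The homomorphism `ζ : △_q → 𝔥_q` -/

section Zeta

variable {F : Type*} [Field F] {q : F}

/-- The element `t_i + t_i⁻¹` of the centre. -/
def DAHA.c (F : Type*) [Field F] (q : F) (i : Fin 4) : Subalgebra.center F (DAHA F q) :=
  ⟨DAHA.t F q i + DAHA.tInv F q i,
    Subalgebra.mem_center_iff.2 fun x => (DAHA.central F q i x).symm⟩

instance : IsScalarTower (Subalgebra.center F (DAHA F q)) (DAHA F q) (DAHA F q) :=
  ⟨fun a x y => by simp only [Subalgebra.smul_def, smul_eq_mul, mul_assoc]⟩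

instance : SMulCommClass (Subalgebra.center F (DAHA F q)) (DAHA F q) (DAHA F q) :=
  ⟨fun a x y => by
    simp only [Subalgebra.smul_def, smul_eq_mul, ← mul_assoc]
    rw [Subalgebra.mem_center_iff.1 a.2 x]⟩

theorem DAHA.tInv_eq (i : Fin 4) :
    DAHA.tInv F q i = DAHA.c F q i • (1 : DAHA F q) - DAHA.t F q i := by
  rw [Subalgebra.smul_def, smul_eq_mul, mul_one]
  simp [DAHA.c]

theorem DAHA.t_sq (i : Fin 4) :
    DAHA.t F q i * DAHA.t F q i = DAHA.c F q i • DAHA.t F q i - 1 := by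
  rw [Subalgebra.smul_def, smul_eq_mul, ← DAHA.tInv_mul_t F q i]
  simp [DAHA.c, add_mul]

theorem DAHA.t_zero_comm (i : Fin 4) :
    DAHA.t F q 0 * DAHA.w F q i = DAHA.w F q i * DAHA.t F q 0 := by
  have h := zeta_aux_comm (DAHA.c F q 0) (DAHA.c F q i) _ (DAHA.t F q i) (DAHA.t_sq 0)
  rw [← DAHA.tInv_eq, ← DAHA.tInv_eq] at h
  exact h

theorem DAHA.tInv_zero_comm (i : Fin 4) :
    DAHA.tInv F q 0 * DAHA.w F q i = DAHA.w F q i * DAHA.tInv F q 0 := by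
  rw [DAHA.tInv_eq, sub_mul, mul_sub, DAHA.t_zero_comm]
  simp

theorem DAHA.t_one_eq : DAHA.t F q 1 =
    q⁻¹ • (DAHA.tInv F q 0 * DAHA.tInv F q 3 * DAHA.tInv F q 2) := by
  have h := DAHA.t_prod F q
  have h' : DAHA.t F q 1 = DAHA.tInv F q 0 *
      (DAHA.t F q 0 * DAHA.t F q 1 * DAHA.t F q 2 * DAHA.t F q 3) *
        DAHA.tInv F q 3 * DAHA.tInv F q 2 := by
    have h1 : ∀ x, DAHA.tInv F q 0 * (DAHA.t F q 0 * x) = x := fun x => by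
      rw [← mul_assoc, DAHA.tInv_mul_t, one_mul]
    have h2 : ∀ x, DAHA.t F q 3 * (DAHA.tInv F q 3 * x) = x := fun x => by
      rw [← mul_assoc, DAHA.t_mul_tInv, one_mul]
    simp only [mul_assoc, h1, h2, DAHA.t_mul_tInv, mul_one]
  rw [h', h, Algebra.algebraMap_eq_smul_one]
  simp only [mul_smul_comm, smul_mul_assoc, mul_one]

theorem DAHA.tInv_one_eq (hq : q ≠ 0) : DAHA.tInv F q 1 =
    q • (DAHA.t F q 2 * DAHA.t F q 3 * DAHA.t F q 0) := by
  have h1 : DAHA.t F q 1 * (q • (DAHA.t F q 2 * DAHA.t F q 3 * DAHA.t F q 0)) = 1 := by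
    have h2 : ∀ x, DAHA.tInv F q 2 * (DAHA.t F q 2 * x) = x := fun x => by
      rw [← mul_assoc, DAHA.tInv_mul_t, one_mul]
    have h3 : ∀ x, DAHA.tInv F q 3 * (DAHA.t F q 3 * x) = x := fun x => by
      rw [← mul_assoc, DAHA.tInv_mul_t, one_mul]
    rw [DAHA.t_one_eq]
    simp only [mul_smul_comm, smul_mul_assoc, mul_assoc, h2, h3, DAHA.tInv_mul_t, smul_smul,
      mul_inv_cancel₀ hq, one_smul]
  calc DAHA.tInv F q 1 = DAHA.tInv F q 1 *
        (DAHA.t F q 1 * (q • (DAHA.t F q 2 * DAHA.t F q 3 * DAHA.t F q 0))) := by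
          rw [h1, mul_one]
    _ = _ := by rw [← mul_assoc, DAHA.tInv_mul_t, one_mul]

theorem DAHA.rel_one :
    DAHA.t F q 1 + DAHA.tInv F q 1 - DAHA.c F q 1 • (1 : DAHA F q) = 0 := by
  rw [DAHA.tInv_eq]; abel

theorem NotRootOfUnity.sq_sub_ne {q : F} (hq : NotRootOfUnity q) : q ^ 2 - q⁻¹ ^ 2 ≠ 0 := by
  intro h
  apply hq.2 4 (by norm_num)
  have h0 := hq.1
  field_simp at h
  linear_combination h

theorem zeta_center_of {x y z : Fin 4} (hq : NotRootOfUnity q)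
    (a b : Subalgebra.center F (DAHA F q))
    (h : ((algebraMap F (Subalgebra.center F (DAHA F q)) q) ^ 2 -
          (algebraMap F (Subalgebra.center F (DAHA F q)) q⁻¹) ^ 2) • DAHA.w F q x +
        (algebraMap F (Subalgebra.center F (DAHA F q)) q • (DAHA.w F q y * DAHA.w F q z) -
          algebraMap F (Subalgebra.center F (DAHA F q)) q⁻¹ • (DAHA.w F q z * DAHA.w F q y)) =
      (algebraMap F (Subalgebra.center F (DAHA F q)) q -
          algebraMap F (Subalgebra.center F (DAHA F q)) q⁻¹) •
        (a • (1 : DAHA F q) + b • (algebraMap F (Subalgebra.center F (DAHA F q)) q •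
          DAHA.tInv F q 0 + algebraMap F (Subalgebra.center F (DAHA F q)) q⁻¹ • DAHA.t F q 0)))
    (i : Fin 4) :
    awElt q (DAHA.w F q x) (DAHA.w F q y) (DAHA.w F q z) * DAHA.w F q i =
      DAHA.w F q i * awElt q (DAHA.w F q x) (DAHA.w F q y) (DAHA.w F q z) := by
  have hne := hq.sq_sub_ne
  have e : awElt q (DAHA.w F q x) (DAHA.w F q y) (DAHA.w F q z) =
      (q ^ 2 - q⁻¹ ^ 2)⁻¹ • ((q - q⁻¹) • (a • (1 : DAHA F q) +
        b • (q • DAHA.tInv F q 0 + q⁻¹ • DAHA.t F q 0))) := by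
    rw [← map_pow, ← map_pow, ← map_sub, ← map_sub] at h
    simp only [algebraMap_smul] at h
    rw [← h, smul_add, smul_smul, inv_mul_cancel₀ hne, one_smul, awElt]
  rw [e]
  simp only [smul_mul_assoc, mul_smul_comm, add_mul, mul_add, one_mul, mul_one,
    DAHA.t_zero_comm, DAHA.tInv_zero_comm]

theorem center_inv_mul (hq : NotRootOfUnity q) :
    algebraMap F (Subalgebra.center F (DAHA F q)) q⁻¹ *
      algebraMap F (Subalgebra.center F (DAHA F q)) q = 1 := by
  rw [← map_mul, inv_mul_cancel₀ hq.1, map_one]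

theorem DAHA.t_one_eq' : DAHA.t F q 1 = algebraMap F (Subalgebra.center F (DAHA F q)) q⁻¹ •
    (DAHA.tInv F q 0 * DAHA.tInv F q 3 * DAHA.tInv F q 2) := by
  rw [algebraMap_smul]; exact DAHA.t_one_eq

theorem DAHA.tInv_one_eq' (hq : q ≠ 0) : DAHA.tInv F q 1 =
    algebraMap F (Subalgebra.center F (DAHA F q)) q •
      (DAHA.t F q 2 * DAHA.t F q 3 * DAHA.t F q 0) := by
  rw [algebraMap_smul]; exact DAHA.tInv_one_eq hq

theorem zeta_alpha (hq : NotRootOfUnity q) (i : Fin 4) :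
    awElt q (DAHA.w F q 1) (DAHA.w F q 3) (DAHA.w F q 2) * DAHA.w F q i =
      DAHA.w F q i * awElt q (DAHA.w F q 1) (DAHA.w F q 3) (DAHA.w F q 2) :=
  zeta_center_of hq _ _ (zeta_aux_alpha _ _ (DAHA.c F q 0) (DAHA.c F q 1) (DAHA.c F q 2)
    (DAHA.c F q 3) (DAHA.t F q 0) (DAHA.t F q 1) (DAHA.t F q 2) (DAHA.t F q 3)
    (DAHA.tInv F q 0) (DAHA.tInv F q 1) (DAHA.tInv F q 2) (DAHA.tInv F q 3)
    (center_inv_mul hq) (DAHA.t_sq 0) (DAHA.t_sq 2) (DAHA.t_sq 3)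
    (DAHA.tInv_eq 0) (DAHA.tInv_eq 2) (DAHA.tInv_eq 3)
    DAHA.t_one_eq' (DAHA.tInv_one_eq' hq.1) DAHA.rel_one) i

theorem zeta_beta (hq : NotRootOfUnity q) (i : Fin 4) :
    awElt q (DAHA.w F q 3) (DAHA.w F q 2) (DAHA.w F q 1) * DAHA.w F q i =
      DAHA.w F q i * awElt q (DAHA.w F q 3) (DAHA.w F q 2) (DAHA.w F q 1) :=
  zeta_center_of hq _ _ (zeta_aux_beta _ _ (DAHA.c F q 0) (DAHA.c F q 1) (DAHA.c F q 2)
    (DAHA.c F q 3) (DAHA.t F q 0) (DAHA.t F q 1) (DAHA.t F q 2) (DAHA.t F q 3)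
    (DAHA.tInv F q 0) (DAHA.tInv F q 1) (DAHA.tInv F q 2) (DAHA.tInv F q 3)
    (center_inv_mul hq) (DAHA.t_sq 0) (DAHA.t_sq 2) (DAHA.t_sq 3)
    (DAHA.tInv_eq 0) (DAHA.tInv_eq 2) (DAHA.tInv_eq 3)
    DAHA.t_one_eq' (DAHA.tInv_one_eq' hq.1) DAHA.rel_one) i

theorem zeta_gamma (hq : NotRootOfUnity q) (i : Fin 4) :
    awElt q (DAHA.w F q 2) (DAHA.w F q 1) (DAHA.w F q 3) * DAHA.w F q i =
      DAHA.w F q i * awElt q (DAHA.w F q 2) (DAHA.w F q 1) (DAHA.w F q 3) :=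
  zeta_center_of hq _ _ (zeta_aux_gamma _ _ (DAHA.c F q 0) (DAHA.c F q 1) (DAHA.c F q 2)
    (DAHA.c F q 3) (DAHA.t F q 0) (DAHA.t F q 1) (DAHA.t F q 2) (DAHA.t F q 3)
    (DAHA.tInv F q 0) (DAHA.tInv F q 1) (DAHA.tInv F q 2) (DAHA.tInv F q 3)
    (center_inv_mul hq) (DAHA.t_sq 0) (DAHA.t_sq 2) (DAHA.t_sq 3)
    (DAHA.tInv_eq 0) (DAHA.tInv_eq 2) (DAHA.tInv_eq 3)
    DAHA.t_one_eq' (DAHA.tInv_one_eq' hq.1) DAHA.rel_one) i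

theorem map_awElt {R S : Type*} [Ring R] [Algebra F R] [Ring S] [Algebra F S] (f : R →ₐ[F] S)
    (x y z : R) : f (awElt q x y z) = awElt q (f x) (f y) (f z) := by
  simp [awElt]

theorem zeta_rel (hq : NotRootOfUnity q) ⦃x y : FreeAlgebra F AWGen⦄ (h : AWRel F q x y) :
    FreeAlgebra.lift F (zetaGen F q) x = FreeAlgebra.lift F (zetaGen F q) y := by
  cases h with
  | alpha g =>
    rw [map_mul, map_mul, map_awElt]
    simp only [FreeAlgebra.lift_ι_apply]
    cases g <;> exact zeta_alpha hq _
  | beta g =>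
    rw [map_mul, map_mul, map_awElt]
    simp only [FreeAlgebra.lift_ι_apply]
    cases g <;> exact zeta_beta hq _
  | gamma g =>
    rw [map_mul, map_mul, map_awElt]
    simp only [FreeAlgebra.lift_ι_apply]
    cases g <;> exact zeta_gamma hq _

/-- The homomorphism `ζ : △_q → 𝔥_q` with `A ↦ t₁t₀ + (t₁t₀)⁻¹`, `B ↦ t₃t₀ + (t₃t₀)⁻¹`,
`C ↦ t₂t₀ + (t₂t₀)⁻¹`. -/
def zeta (hq : NotRootOfUnity q) : AW F q →ₐ[F] DAHA F q :=
  RingQuot.liftAlgHom F ⟨FreeAlgebra.lift F (zetaGen F q), zeta_rel hq⟩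

theorem zeta_gen (hq : NotRootOfUnity q) (g : AWGen) :
    zeta hq (AW.gen F q g) = zetaGen F q g := by
  rw [zeta, AW.gen]
  erw [RingQuot.liftAlgHom_mkAlgHom_apply]
  rw [FreeAlgebra.lift_ι_apply]

theorem t_zero_comm_zeta (hq : NotRootOfUnity q) (x : AW F q) :
    DAHA.t F q 0 * zeta hq x = zeta hq x * DAHA.t F q 0 := by
  obtain ⟨x, rfl⟩ := RingQuot.mkAlgHom_surjective F (AWRel F q) x
  induction x using FreeAlgebra.induction with
  | grade0 r =>
    rw [AlgHom.commutes]
    erw [AlgHom.commutes]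
    exact (Algebra.commutes r _).symm
  | grade1 g =>
    have h := zeta_gen hq g
    rw [AW.gen] at h
    rw [h]
    cases g <;> exact DAHA.t_zero_comm _
  | mul a b ha hb =>
    rw [map_mul]
    erw [map_mul]
    rw [← mul_assoc, ha, mul_assoc, hb, mul_assoc]
  | add a b ha hb =>
    rw [map_add]
    erw [map_add]
    rw [mul_add, add_mul, ha, hb]

end Zeta


/-! ### The `𝔥_q`-module `O(k₀,k₁,k₂,k₃)` of dimension `d + 1` -/

section OModule

variable {F : Type*} [Field F] {q : F}

/-- The basis vector `v_i` for `0 ≤ i ≤ d`; by convention `v_i = 0` for `i > d`. -/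
def vec (F : Type*) [Field F] (d i : ℕ) : Fin (d + 1) → F :=
  if h : i < d + 1 then Pi.single ⟨i, h⟩ 1 else 0

/-- The linear map with `v_i ↦ f i` for `0 ≤ i ≤ d`. -/
def ofImages {d : ℕ} (f : ℕ → Fin (d + 1) → F) : Module.End F (Fin (d + 1) → F) :=
  (Pi.basisFun F (Fin (d + 1))).constr F fun i => f i

/-- The image of `v_i` under `t_0`. For `i = 0` the first coefficient vanishes, so that
`t_0 v_0 = k_0 v_0`. -/
def imageT0 (q : F) (d : ℕ) (k0 : F) (i : ℕ) : Fin (d + 1) → F :=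
  if Even i then
    (k0⁻¹ * q ^ (-(i : ℤ)) * (1 - q ^ i) * (1 - k0 ^ 2 * q ^ i)) • vec F d (i - 1)
      + (k0 + k0⁻¹ - k0⁻¹ * q ^ (-(i : ℤ))) • vec F d i
  else
    (k0⁻¹ * q ^ (-(i : ℤ) - 1)) • (vec F d i - vec F d (i + 1))

/-- The image of `v_i` under `t_1`. For `i = 0` the first coefficient vanishes and for `i = d`
the last vector does, so that `t_1 v_0 = k_1 v_0 + k_1⁻¹ v_1` if `d ≥ 2` and
`t_1 v_d = -k_1 (1 - q^d) (1 - k_0² q^d) v_{d-1} + k_1 v_d`. -/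
def imageT1 (q : F) (d : ℕ) (k0 k1 : F) (i : ℕ) : Fin (d + 1) → F :=
  if Even i then
    (-k1 * (1 - q ^ i) * (1 - k0 ^ 2 * q ^ i)) • vec F d (i - 1)
      + k1 • vec F d i + k1⁻¹ • vec F d (i + 1)
  else
    k1⁻¹ • vec F d i

/-- The image of `v_i` under `t_2`. For `i = d` this is `t_2 v_d = k_2 v_d`. -/
def imageT2 (q : F) (d : ℕ) (k2 : F) (i : ℕ) : Fin (d + 1) → F :=
  if Even i then
    (k2 * q ^ ((d : ℤ) - i)) • (vec F d i - vec F d (i + 1))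
  else
    (-k2 * (1 - k2⁻¹ ^ 2 * q ^ ((i : ℤ) - d - 1)) * (1 - q ^ ((d : ℤ) - i + 1))) • vec F d (i - 1)
      + (k2 + k2⁻¹ - k2 * q ^ ((d : ℤ) - i + 1)) • vec F d i

/-- The image of `v_i` under `t_3`. -/
def imageT3 (q : F) (d : ℕ) (k2 k3 : F) (i : ℕ) : Fin (d + 1) → F :=
  if Even i then
    k3 • vec F d i
  else
    (-k3⁻¹ * (1 - k2⁻¹ ^ 2 * q ^ ((i : ℤ) - d - 1)) * (1 - q ^ ((i : ℤ) - d - 1))) • vec F d (i - 1)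
      + k3⁻¹ • vec F d i + k3 • vec F d (i + 1)

/-- The operators by which `t_0, t_1, t_2, t_3` act on `O(k₀,k₁,k₂,k₃)`. -/
def actT (q : F) (d : ℕ) (k0 k1 k2 k3 : F) : Fin 4 → Module.End F (Fin (d + 1) → F) :=
  ![ofImages (imageT0 q d k0), ofImages (imageT1 q d k0 k1), ofImages (imageT2 q d k2),
    ofImages (imageT3 q d k2 k3)]

/-- The operators by which all the generators act: `t_i⁻¹` acts as `k_i + k_i⁻¹ - t_i`. -/
def actGen (q : F) (d : ℕ) (k0 k1 k2 k3 : F) : DAHAGen → Module.End F (Fin (d + 1) → F)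
  | DAHAGen.t i => actT q d k0 k1 k2 k3 i
  | DAHAGen.tInv i =>
      algebraMap F _ (![k0, k1, k2, k3] i + (![k0, k1, k2, k3] i)⁻¹) - actT q d k0 k1 k2 k3 i

theorem vec_of_lt {d i : ℕ} (h : d < i) : vec F d i = 0 := by
  rw [vec, dif_neg (by omega)]

theorem ofImages_vec {d : ℕ} (f : ℕ → Fin (d + 1) → F) (hf : ∀ i, d < i → f i = 0) (i : ℕ) :
    ofImages f (vec F d i) = f i := by
  by_cases h : i < d + 1
  · rw [vec, dif_pos h]
    have := (Pi.basisFun F (Fin (d + 1))).constr_basis F (fun i => f i) ⟨i, h⟩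
    rwa [Pi.basisFun_apply] at this
  · rw [vec_of_lt (by omega), map_zero, hf i (by omega)]

theorem end_ext {d : ℕ} (hd : Even d) {f g : Module.End F (Fin (d + 1) → F)}
    (h0 : ∀ m, f (vec F d (2 * m)) = g (vec F d (2 * m)))
    (h1 : ∀ m, f (vec F d (2 * m + 1)) = g (vec F d (2 * m + 1))) : f = g := by
  have h : ∀ i, f (vec F d i) = g (vec F d i) := fun i => by
    rcases Nat.even_or_odd' i with ⟨m, rfl | rfl⟩
    · exact h0 m
    · exact h1 m
  refine (Pi.basisFun F (Fin (d + 1))).ext fun i => ?_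
  have := h i
  rw [vec, dif_pos i.2] at this
  rwa [Pi.basisFun_apply]

section Action

variable {d : ℕ} {k0 k1 k2 k3 : F}

theorem even_two_mul' (m : ℕ) : Even (2 * m) := even_two_mul m

theorem not_even_two_mul_add_one (m : ℕ) : ¬ Even (2 * m + 1) := by
  rw [Nat.not_even_iff_odd]; exact ⟨m, rfl⟩

theorem act0 (hd : Even d) (i : ℕ) :
    ofImages (imageT0 q d k0) (vec F d i) = imageT0 q d k0 i := by
  refine ofImages_vec _ (fun i hi => ?_) i
  obtain ⟨n, rfl⟩ := hd
  rw [imageT0]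
  split_ifs with h
  · obtain ⟨m, rfl⟩ := h
    rw [vec_of_lt (by omega), vec_of_lt (by omega)]; simp
  · rw [vec_of_lt (by omega), vec_of_lt (by omega)]; simp

theorem act1 (hd : Even d) (i : ℕ) :
    ofImages (imageT1 q d k0 k1) (vec F d i) = imageT1 q d k0 k1 i := by
  refine ofImages_vec _ (fun i hi => ?_) i
  obtain ⟨n, rfl⟩ := hd
  rw [imageT1]
  split_ifs with h
  · obtain ⟨m, rfl⟩ := h
    rw [vec_of_lt (by omega), vec_of_lt (by omega), vec_of_lt (by omega)]; simp
  · rw [vec_of_lt (by omega)]; simp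

theorem act2 (i : ℕ) :
    ofImages (imageT2 q d k2) (vec F d i) = imageT2 q d k2 i := by
  refine ofImages_vec _ (fun i hi => ?_) i
  rw [imageT2]
  split_ifs with h
  · rw [vec_of_lt (by omega), vec_of_lt (by omega)]; simp
  · rcases Nat.lt_or_ge (d + 1) i with h' | h'
    · rw [vec_of_lt (by omega), vec_of_lt (by omega)]; simp
    · obtain rfl : i = d + 1 := by omega
      rw [vec_of_lt (i := d + 1) (by omega)]
      simp

theorem act3 (i : ℕ) :
    ofImages (imageT3 q d k2 k3) (vec F d i) = imageT3 q d k2 k3 i := by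
  refine ofImages_vec _ (fun i hi => ?_) i
  rw [imageT3]
  split_ifs with h
  · rw [vec_of_lt (by omega)]; simp
  · rcases Nat.lt_or_ge (d + 1) i with h' | h'
    · rw [vec_of_lt (by omega), vec_of_lt (by omega), vec_of_lt (by omega)]; simp
    · obtain rfl : i = d + 1 := by omega
      rw [vec_of_lt (i := d + 1) (by omega), vec_of_lt (i := d + 1 + 1) (by omega)]
      simp

theorem act0_even_zero (hd : Even d) :
    ofImages (imageT0 q d k0) (vec F d (2 * 0)) = k0 • vec F d (2 * 0) := by
  rw [act0 hd, imageT0, if_pos (even_two_mul _)]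
  simp

theorem act0_even_succ (hq : q ≠ 0) (hd : Even d) (m : ℕ) :
    ofImages (imageT0 q d k0) (vec F d (2 * (m + 1))) =
      (k0⁻¹ * ((q ^ (2 * m))⁻¹ * (q ^ 2)⁻¹) * (1 - q ^ (2 * m) * q ^ 2) *
        (1 - k0 ^ 2 * (q ^ (2 * m) * q ^ 2))) • vec F d (2 * m + 1)
      + (k0 + k0⁻¹ - k0⁻¹ * ((q ^ (2 * m))⁻¹ * (q ^ 2)⁻¹)) • vec F d (2 * (m + 1)) := by
  rw [act0 hd, imageT0, if_pos (even_two_mul _), zpow_neg, zpow_natCast,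
    show 2 * (m + 1) = 2 * m + 2 from rfl, pow_add, mul_inv]
  rfl

theorem act0_odd (hq : q ≠ 0) (hd : Even d) (m : ℕ) :
    ofImages (imageT0 q d k0) (vec F d (2 * m + 1)) =
      (k0⁻¹ * ((q ^ (2 * m))⁻¹ * (q ^ 2)⁻¹)) • (vec F d (2 * m + 1) - vec F d (2 * (m + 1))) := by
  rw [act0 hd, imageT0, if_neg (not_even_two_mul_add_one _),
    show -((2 * m + 1 : ℕ) : ℤ) - 1 = -((2 * m + 2 : ℕ) : ℤ) by push_cast; ring,
    zpow_neg, zpow_natCast, pow_add, mul_inv]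
  rfl

theorem act1_even_zero (hd : Even d) :
    ofImages (imageT1 q d k0 k1) (vec F d (2 * 0)) =
      k1 • vec F d (2 * 0) + k1⁻¹ • vec F d (2 * 0 + 1) := by
  rw [act1 hd, imageT1, if_pos (even_two_mul _)]
  simp

theorem act1_even_succ (hd : Even d) (m : ℕ) :
    ofImages (imageT1 q d k0 k1) (vec F d (2 * (m + 1))) =
      (-k1 * (1 - q ^ (2 * m) * q ^ 2) *
        (1 - k0 ^ 2 * (q ^ (2 * m) * q ^ 2))) • vec F d (2 * m + 1)
      + k1 • vec F d (2 * (m + 1)) + k1⁻¹ • vec F d (2 * (m + 1) + 1) := by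
  rw [act1 hd, imageT1, if_pos (even_two_mul _),
    show 2 * (m + 1) = 2 * m + 2 from rfl, pow_add]
  rfl

theorem act1_odd (hd : Even d) (m : ℕ) :
    ofImages (imageT1 q d k0 k1) (vec F d (2 * m + 1)) = k1⁻¹ • vec F d (2 * m + 1) := by
  rw [act1 hd, imageT1, if_neg (not_even_two_mul_add_one _)]

theorem act2_even (hq : q ≠ 0) (m : ℕ) :
    ofImages (imageT2 q d k2) (vec F d (2 * m)) =
      (k2 * (q ^ d * (q ^ (2 * m))⁻¹)) • (vec F d (2 * m) - vec F d (2 * m + 1)) := by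
  rw [act2, imageT2, if_pos (even_two_mul _), zpow_sub₀ hq, zpow_natCast, zpow_natCast,
    div_eq_mul_inv]

theorem zpow_aux1 (hq : q ≠ 0) (d m : ℕ) :
    q ^ (((2 * m + 1 : ℕ) : ℤ) - d - 1) = q ^ (2 * m) * (q ^ d)⁻¹ := by
  rw [show ((2 * m + 1 : ℕ) : ℤ) - d - 1 = ((2 * m : ℕ) : ℤ) - (d : ℕ) by push_cast; ring,
    zpow_sub₀ hq, zpow_natCast, zpow_natCast, div_eq_mul_inv]

theorem zpow_aux2 (hq : q ≠ 0) (d m : ℕ) :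
    q ^ ((d : ℤ) - ((2 * m + 1 : ℕ) : ℤ) + 1) = q ^ d * (q ^ (2 * m))⁻¹ := by
  rw [show (d : ℤ) - ((2 * m + 1 : ℕ) : ℤ) + 1 = (d : ℤ) - ((2 * m : ℕ) : ℤ) by push_cast; ring,
    zpow_sub₀ hq, zpow_natCast, zpow_natCast, div_eq_mul_inv]

theorem act2_odd (hq : q ≠ 0) (m : ℕ) :
    ofImages (imageT2 q d k2) (vec F d (2 * m + 1)) =
      (-k2 * (1 - k2⁻¹ ^ 2 * (q ^ (2 * m) * (q ^ d)⁻¹)) *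
        (1 - q ^ d * (q ^ (2 * m))⁻¹)) • vec F d (2 * m)
      + (k2 + k2⁻¹ - k2 * (q ^ d * (q ^ (2 * m))⁻¹)) • vec F d (2 * m + 1) := by
  rw [act2, imageT2, if_neg (not_even_two_mul_add_one _), zpow_aux1 hq, zpow_aux2 hq,
    Nat.add_sub_cancel]

theorem act3_even (m : ℕ) :
    ofImages (imageT3 q d k2 k3) (vec F d (2 * m)) = k3 • vec F d (2 * m) := by
  rw [act3, imageT3, if_pos (even_two_mul _)]

theorem act3_odd (hq : q ≠ 0) (m : ℕ) :
    ofImages (imageT3 q d k2 k3) (vec F d (2 * m + 1)) =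
      (-k3⁻¹ * (1 - k2⁻¹ ^ 2 * (q ^ (2 * m) * (q ^ d)⁻¹)) *
        (1 - q ^ (2 * m) * (q ^ d)⁻¹)) • vec F d (2 * m)
      + k3⁻¹ • vec F d (2 * m + 1) + k3 • vec F d (2 * (m + 1)) := by
  rw [act3, imageT3, if_neg (not_even_two_mul_add_one _), zpow_aux1 hq, Nat.add_sub_cancel]
  rfl

theorem act0_quad (hq : q ≠ 0) (hd : Even d) (hk0 : k0 ≠ 0) :
    ofImages (imageT0 q d k0) * ofImages (imageT0 q d k0) =
      (k0 + k0⁻¹) • ofImages (imageT0 q d k0) - 1 := by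
  refine end_ext hd (fun m => ?_) fun m => ?_
  · cases m with
    | zero =>
      simp only [Module.End.mul_apply, LinearMap.sub_apply, LinearMap.smul_apply,
        Module.End.one_apply, act0_even_zero hd, map_smul]
      match_scalars
      field_simp
      ring
    | succ m =>
      simp only [Module.End.mul_apply, LinearMap.sub_apply, LinearMap.smul_apply,
        Module.End.one_apply, act0_even_succ hq hd, act0_odd hq hd, map_smul, map_add, map_sub]
      have hx : q ^ (2 * m) ≠ 0 := pow_ne_zero _ hq
      generalize q ^ (2 * m) = x at hx ⊢
      match_scalars <;> field_simp <;> ring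
  · simp only [Module.End.mul_apply, LinearMap.sub_apply, LinearMap.smul_apply,
      Module.End.one_apply, act0_even_succ hq hd, act0_odd hq hd, map_smul, map_add, map_sub]
    have hx : q ^ (2 * m) ≠ 0 := pow_ne_zero _ hq
    generalize q ^ (2 * m) = x at hx ⊢
    match_scalars <;> field_simp <;> ring

theorem act1_quad (hd : Even d) (hk1 : k1 ≠ 0) :
    ofImages (imageT1 q d k0 k1) * ofImages (imageT1 q d k0 k1) =
      (k1 + k1⁻¹) • ofImages (imageT1 q d k0 k1) - 1 := by
  refine end_ext hd (fun m => ?_) fun m => ?_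
  · cases m with
    | zero =>
      simp only [Module.End.mul_apply, LinearMap.sub_apply, LinearMap.smul_apply,
        Module.End.one_apply, act1_even_zero hd, act1_odd hd, map_smul, map_add]
      match_scalars <;> field_simp <;> ring
    | succ m =>
      simp only [Module.End.mul_apply, LinearMap.sub_apply, LinearMap.smul_apply,
        Module.End.one_apply, act1_even_succ hd, act1_odd hd, map_smul, map_add]
      match_scalars <;> field_simp <;> ring
  · simp only [Module.End.mul_apply, LinearMap.sub_apply, LinearMap.smul_apply,
      Module.End.one_apply, act1_odd hd, map_smul]
    match_scalars
    field_simp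
    ring

theorem act2_quad (hq : q ≠ 0) (hd : Even d) (hk2 : k2 ≠ 0) :
    ofImages (imageT2 q d k2) * ofImages (imageT2 q d k2) =
      (k2 + k2⁻¹) • ofImages (imageT2 q d k2) - 1 := by
  have hD : q ^ d ≠ 0 := pow_ne_zero _ hq
  refine end_ext hd (fun m => ?_) fun m => ?_
  all_goals
    simp only [Module.End.mul_apply, LinearMap.sub_apply, LinearMap.smul_apply,
      Module.End.one_apply, act2_even hq, act2_odd hq, map_smul, map_add, map_sub]
    have hx : q ^ (2 * m) ≠ 0 := pow_ne_zero _ hq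
    generalize q ^ (2 * m) = x at hx ⊢
    generalize q ^ d = D at hD ⊢
    match_scalars <;> field_simp <;> ring

theorem act3_quad (hq : q ≠ 0) (hd : Even d) (hk3 : k3 ≠ 0) :
    ofImages (imageT3 q d k2 k3) * ofImages (imageT3 q d k2 k3) =
      (k3 + k3⁻¹) • ofImages (imageT3 q d k2 k3) - 1 := by
  refine end_ext hd (fun m => ?_) fun m => ?_
  all_goals
    simp only [Module.End.mul_apply, LinearMap.sub_apply, LinearMap.smul_apply,
      Module.End.one_apply, act3_even, act3_odd hq, map_smul, map_add]
    match_scalars <;> field_simp <;> ring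

theorem act_prod (hq : q ≠ 0) (hd : Even d) (hk0 : k0 ≠ 0) (hk1 : k1 ≠ 0) (hk2 : k2 ≠ 0)
    (hk3 : k3 ≠ 0) (hk : k0 * k1 * k2 * k3 = q ^ (-(d : ℤ) - 1)) :
    ofImages (imageT0 q d k0) * ofImages (imageT1 q d k0 k1) * ofImages (imageT2 q d k2) *
      ofImages (imageT3 q d k2 k3) = algebraMap F _ q⁻¹ := by
  have hD : q ^ d ≠ 0 := pow_ne_zero _ hq
  have hk' : k3 = (k0 * k1 * k2 * q ^ d * q)⁻¹ := by
    rw [show -(d : ℤ) - 1 = -((d + 1 : ℕ) : ℤ) by push_cast; ring, zpow_neg, zpow_natCast,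
      pow_succ] at hk
    field_simp at hk ⊢
    linear_combination hk
  refine end_ext hd (fun m => ?_) fun m => ?_
  · cases m with
    | zero =>
      simp only [Module.End.mul_apply, Module.algebraMap_end_apply, act0_even_zero hd,
        act1_even_zero hd, act1_odd hd, act2_even hq, act2_odd hq, act3_even,
        act3_odd hq, act0_odd hq hd, map_smul, map_add, map_sub, act0_even_succ hq hd,
        act1_even_succ hd]
      subst hk'
      generalize q ^ d = D at hD ⊢
      match_scalars <;> field_simp <;> ring
    | succ m =>
      have hx' : q ^ (2 * (m + 1)) = q ^ (2 * m) * q ^ 2 := by ring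
      simp only [Module.End.mul_apply, Module.algebraMap_end_apply,
        act1_odd hd, act2_even hq, act2_odd hq, act3_even,
        act3_odd hq, act0_odd hq hd, map_smul, map_add, map_sub, act0_even_succ hq hd,
        act1_even_succ hd, hx']
      subst hk'
      have hx : q ^ (2 * m) ≠ 0 := pow_ne_zero _ hq
      generalize q ^ (2 * m) = x at hx ⊢
      generalize q ^ d = D at hD ⊢
      match_scalars <;> field_simp <;> ring
  · cases m with
    | zero =>
      simp only [Module.End.mul_apply, Module.algebraMap_end_apply, act0_even_zero hd,
        act1_even_zero hd, act1_odd hd, act2_even hq, act2_odd hq, act3_even,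
        act3_odd hq, act0_odd hq hd, map_smul, map_add, map_sub, act0_even_succ hq hd,
        act1_even_succ hd]
      subst hk'
      generalize q ^ d = D at hD ⊢
      match_scalars <;> field_simp <;> ring
    | succ m =>
      have hx' : q ^ (2 * (m + 1)) = q ^ (2 * m) * q ^ 2 := by ring
      have hx'' : q ^ (2 * (m + 1 + 1)) = q ^ (2 * m) * q ^ 2 * q ^ 2 := by ring
      simp only [Module.End.mul_apply, Module.algebraMap_end_apply,
        act1_odd hd, act2_even hq, act2_odd hq, act3_even,
        act3_odd hq, act0_odd hq hd, map_smul, map_add, map_sub, act0_even_succ hq hd,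
        act1_even_succ hd, hx', hx'']
      subst hk'
      have hx : q ^ (2 * m) ≠ 0 := pow_ne_zero _ hq
      generalize q ^ (2 * m) = x at hx ⊢
      generalize q ^ d = D at hD ⊢
      match_scalars <;> field_simp <;> ring

theorem actT_quad (hq : q ≠ 0) (hd : Even d) (hk0 : k0 ≠ 0) (hk1 : k1 ≠ 0) (hk2 : k2 ≠ 0)
    (hk3 : k3 ≠ 0) (i : Fin 4) :
    actT q d k0 k1 k2 k3 i * actT q d k0 k1 k2 k3 i =
      (![k0, k1, k2, k3] i + (![k0, k1, k2, k3] i)⁻¹) • actT q d k0 k1 k2 k3 i - 1 := by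
  fin_cases i
  · exact act0_quad hq hd hk0
  · exact act1_quad hd hk1
  · exact act2_quad hq hd hk2
  · exact act3_quad hq hd hk3

theorem act_rel (hq : NotRootOfUnity q) (hd : Even d) (hk0 : k0 ≠ 0) (hk1 : k1 ≠ 0)
    (hk2 : k2 ≠ 0) (hk3 : k3 ≠ 0) (hk : k0 * k1 * k2 * k3 = q ^ (-(d : ℤ) - 1))
    ⦃x y : FreeAlgebra F DAHAGen⦄ (h : DAHARel F q x y) :
    FreeAlgebra.lift F (actGen q d k0 k1 k2 k3) x =
      FreeAlgebra.lift F (actGen q d k0 k1 k2 k3) y := by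
  cases h with
  | mul_inv i =>
    rw [map_mul, map_one, FreeAlgebra.lift_ι_apply, FreeAlgebra.lift_ι_apply, actGen, actGen,
      mul_sub, actT_quad hq.1 hd hk0 hk1 hk2 hk3, ← Algebra.commutes, ← Algebra.smul_def]
    abel
  | inv_mul i =>
    rw [map_mul, map_one, FreeAlgebra.lift_ι_apply, FreeAlgebra.lift_ι_apply, actGen, actGen,
      sub_mul, actT_quad hq.1 hd hk0 hk1 hk2 hk3, ← Algebra.smul_def]
    abel
  | central i x =>
    rw [map_mul, map_mul, map_add, FreeAlgebra.lift_ι_apply, FreeAlgebra.lift_ι_apply, actGen,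
      actGen, add_sub_cancel, Algebra.commutes]
  | prod =>
    rw [map_mul, map_mul, map_mul, AlgHom.commutes]
    simp only [FreeAlgebra.lift_ι_apply]
    exact act_prod hq.1 hd hk0 hk1 hk2 hk3 hk

/-- The representation of `𝔥_q` on `O(k₀,k₁,k₂,k₃)`. -/
def actHom (hq : NotRootOfUnity q) (hd : Even d) (hk0 : k0 ≠ 0) (hk1 : k1 ≠ 0)
    (hk2 : k2 ≠ 0) (hk3 : k3 ≠ 0) (hk : k0 * k1 * k2 * k3 = q ^ (-(d : ℤ) - 1)) :
    DAHA F q →ₐ[F] Module.End F (Fin (d + 1) → F) :=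
  RingQuot.liftAlgHom F ⟨FreeAlgebra.lift F (actGen q d k0 k1 k2 k3),
    act_rel hq hd hk0 hk1 hk2 hk3 hk⟩

theorem actHom_t (hq : NotRootOfUnity q) (hd : Even d) (hk0 : k0 ≠ 0) (hk1 : k1 ≠ 0)
    (hk2 : k2 ≠ 0) (hk3 : k3 ≠ 0) (hk : k0 * k1 * k2 * k3 = q ^ (-(d : ℤ) - 1)) (i : Fin 4) :
    actHom hq hd hk0 hk1 hk2 hk3 hk (DAHA.t F q i) = actT q d k0 k1 k2 k3 i := by
  rw [actHom, DAHA.t]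
  erw [RingQuot.liftAlgHom_mkAlgHom_apply]
  rw [FreeAlgebra.lift_ι_apply]
  rfl

end Action

/-- The underlying space of `O(k₀,k₁,k₂,k₃)`, with basis `v_0, …, v_d`. The arguments are the
parameters and the conditions imposed on them. -/
def OMod {q : F} (_hq : NotRootOfUnity q) {d : ℕ} (_hd : Even d) {k0 k1 k2 k3 : F}
    (_hk0 : k0 ≠ 0) (_hk1 : k1 ≠ 0) (_hk2 : k2 ≠ 0) (_hk3 : k3 ≠ 0)
    (_hk : k0 * k1 * k2 * k3 = q ^ (-(d : ℤ) - 1)) : Type _ := Fin (d + 1) → F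

namespace OMod

variable {d : ℕ} {k0 k1 k2 k3 : F}
variable (hq : NotRootOfUnity q) (hd : Even d) (hk0 : k0 ≠ 0) (hk1 : k1 ≠ 0) (hk2 : k2 ≠ 0)
  (hk3 : k3 ≠ 0) (hk : k0 * k1 * k2 * k3 = q ^ (-(d : ℤ) - 1))

instance : AddCommGroup (OMod hq hd hk0 hk1 hk2 hk3 hk) :=
  inferInstanceAs (AddCommGroup (Fin (d + 1) → F))

instance : Module F (OMod hq hd hk0 hk1 hk2 hk3 hk) :=
  inferInstanceAs (Module F (Fin (d + 1) → F))

/-- The vector `v_i`. -/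
def v (i : ℕ) : OMod hq hd hk0 hk1 hk2 hk3 hk := vec F d i

/-- The `𝔥_q`-module structure on `O(k₀,k₁,k₂,k₃)`. -/
instance : Module (DAHA F q) (OMod hq hd hk0 hk1 hk2 hk3 hk) :=
  Module.compHom (Fin (d + 1) → F) (actHom hq hd hk0 hk1 hk2 hk3 hk).toRingHom

theorem smul_def (x : DAHA F q) (y : OMod hq hd hk0 hk1 hk2 hk3 hk) :
    x • y = actHom hq hd hk0 hk1 hk2 hk3 hk x y := rfl

theorem t_smul (i : Fin 4) (y : OMod hq hd hk0 hk1 hk2 hk3 hk) :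
    DAHA.t F q i • y = actT q d k0 k1 k2 k3 i y := by
  rw [smul_def, actHom_t]

instance : IsScalarTower F (DAHA F q) (OMod hq hd hk0 hk1 hk2 hk3 hk) :=
  ⟨fun a x y => by rw [smul_def, smul_def, map_smul]; rfl⟩

/-- The `△_q`-module structure on `O(k₀,k₁,k₂,k₃)`, by pulling back along `ζ`. -/
instance : Module (AW F q) (OMod hq hd hk0 hk1 hk2 hk3 hk) :=
  Module.compHom _ (zeta hq).toRingHom

theorem AW_smul_def (x : AW F q) (y : OMod hq hd hk0 hk1 hk2 hk3 hk) :
    x • y = zeta hq x • y := rfl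

instance : IsScalarTower F (AW F q) (OMod hq hd hk0 hk1 hk2 hk3 hk) :=
  ⟨fun a x y => by rw [AW_smul_def, AW_smul_def, map_smul, smul_assoc]⟩

instance : SMulCommClass (DAHA F q) F (OMod hq hd hk0 hk1 hk2 hk3 hk) :=
  ⟨fun x a y => by
    rw [smul_def, smul_def]
    exact map_smul (actHom hq hd hk0 hk1 hk2 hk3 hk x) a y⟩

instance : SMulCommClass (AW F q) F (OMod hq hd hk0 hk1 hk2 hk3 hk) :=
  ⟨fun x a y => by rw [AW_smul_def, AW_smul_def, smul_comm]⟩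

/-- The `△_q`-submodule `O(k₀,k₁,k₂,k₃)(θ) = {v | t_0 v = θ v}`. -/
def eigenspace (θ : F) : Submodule (AW F q) (OMod hq hd hk0 hk1 hk2 hk3 hk) where
  carrier := {v | DAHA.t F q 0 • v = θ • v}
  add_mem' {a b} ha hb := by
    simp only [Set.mem_ofPred_eq] at ha hb ⊢
    rw [smul_add, smul_add, ha, hb]
  zero_mem' := by simp only [Set.mem_ofPred_eq, smul_zero]
  smul_mem' x v hv := by
    simp only [Set.mem_ofPred_eq] at hv ⊢
    rw [AW_smul_def, ← mul_smul, t_zero_comm_zeta, mul_smul, hv, smul_comm]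

/-- The `F`-subspace `O(k₀,k₁,k₂,k₃)(k₀)'`, spanned by `v_{i-1} + q^{-i} (v_i - v_{i-1})` for
`i = 2, 4, …, d`. -/
def eigenspace' : Submodule F (OMod hq hd hk0 hk1 hk2 hk3 hk) :=
  Submodule.span F {x | ∃ i : ℕ, 2 ≤ i ∧ i ≤ d ∧ Even i ∧
    x = v hq hd hk0 hk1 hk2 hk3 hk (i - 1) + q ^ (-(i : ℤ)) •
      (v hq hd hk0 hk1 hk2 hk3 hk i - v hq hd hk0 hk1 hk2 hk3 hk (i - 1))}

end OMod

end OModule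

end

end AskeyWilson

open AskeyWilson

/-! Write `c_i` for the scalar `k_i + k_i⁻¹` by which `t_i + t_i⁻¹` acts on `O`, and `w_i = t_i t_0
+ (t_i t_0)⁻¹` for the images of the generators of `△_q`. Since `t_0` commutes with every `w_i`, it
acts `△_q`-linearly, and its quadratic relation reads `(t_0 - k_0)(t_0 - k_0⁻¹) = 0`. The theorem
says that, apart from `{0}` and `O`, only the kernels and images of the two factors are submodules.

Irreducibility over `𝔥_q` is exploited by one criterion (`eq_top_of_t_smul_mem`). If a
`△_q`-submodule `W` is stable under `t_0`, then the vectors `x ∈ W` with all `t_i x ∈ W` form an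
`𝔥_q`-submodule (`core`), because every product `t_i t_j` reduces, through `t_0 t_1 t_2 t_3 = q⁻¹`
and the `w_i`, to operators already known to send `x` into `W`. So a single nonzero such `x` forces
`W = O`.

Let `θ, θ'` be the two roots, and `W ≠ 0` a submodule of the `θ`-eigenspace. For `x ∈ W` one finds
that `w_i x` equals `(t_0 - θ') t_i x` plus a multiple of `x`. Hence the criterion applies to the
preimage of `W` under `t_0 - θ'`, and `W` contains the whole image of `t_0 - θ'`
(`t_zero_sub_mem_of_le_eigenspace`).

If `k_0² ≠ 1`, that image is the `θ`-eigenspace itself, so `O` is the direct sum of two simple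
submodules. Their dimensions `d/2 + 1` and `d/2` differ, so no further submodule can be a complement
of both.

If `k_0² = 1`, the Askey--Wilson relations express `t_0` through the `w_i`, provided that one of
`c_1, c_2, c_3` is nonzero; otherwise `q` would be a root of unity. So every submodule is
`t_0`-stable, and the criterion shows that a proper one lies in `ker (t_0 - k_0)`. A nonzero proper
submodule then lies between the image and the kernel of `t_0 - k_0`, whose dimensions are `d/2` and
`d/2 + 1`. -/

namespace AskeyWilson

/-! ### Products of generators in `𝔥_q` and the Askey--Wilson relations -/

section Relations

variable {F : Type*} [Field F] {q : F}

theorem DAHA.t_mul_tInv_mul (i : Fin 4) (x : DAHA F q) :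
    DAHA.t F q i * (DAHA.tInv F q i * x) = x := by
  rw [← mul_assoc, DAHA.t_mul_tInv, one_mul]

theorem DAHA.tInv_mul_t_mul (i : Fin 4) (x : DAHA F q) :
    DAHA.tInv F q i * (DAHA.t F q i * x) = x := by
  rw [← mul_assoc, DAHA.tInv_mul_t, one_mul]

theorem DAHA.t_one_mul_two_mul_three :
    DAHA.t F q 1 * (DAHA.t F q 2 * DAHA.t F q 3) = q⁻¹ • DAHA.tInv F q 0 := by
  rw [DAHA.t_one_eq]
  simp only [smul_mul_assoc, mul_assoc, DAHA.tInv_mul_t_mul, DAHA.tInv_mul_t, mul_one]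

/-- This and the next identities are rotations of `t_0 t_1 t_2 t_3 = q⁻¹`. They trade a product of
two generators not involving `t_0` for one that begins or ends with `t_0^{±1}`, or collapse a
product of three to one; these are the forms that a `t_0`-stable `△_q`-submodule controls. -/
theorem DAHA.t_one_mul_two :
    DAHA.t F q 1 * DAHA.t F q 2 = q⁻¹ • (DAHA.tInv F q 0 * DAHA.tInv F q 3) := by
  rw [DAHA.t_one_eq]
  simp only [smul_mul_assoc, mul_assoc, DAHA.tInv_mul_t, mul_one]

theorem DAHA.t_two_mul_three :
    DAHA.t F q 2 * DAHA.t F q 3 = q⁻¹ • (DAHA.tInv F q 1 * DAHA.tInv F q 0) := by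
  rw [← DAHA.tInv_mul_t_mul 1 (DAHA.t F q 2 * DAHA.t F q 3), DAHA.t_one_mul_two_mul_three,
    mul_smul_comm]

theorem DAHA.tInv_two_mul_one (hq : q ≠ 0) :
    DAHA.tInv F q 2 * DAHA.tInv F q 1 = q • (DAHA.t F q 3 * DAHA.t F q 0) := by
  rw [DAHA.tInv_one_eq hq]
  simp only [mul_smul_comm, mul_assoc, DAHA.tInv_mul_t_mul]

theorem DAHA.t_three_mul_zero_mul_one (hq : q ≠ 0) :
    DAHA.t F q 3 * (DAHA.t F q 0 * DAHA.t F q 1) = q⁻¹ • DAHA.tInv F q 2 := by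
  have h := congrArg (fun x => q⁻¹ • (x * DAHA.t F q 1)) (DAHA.tInv_two_mul_one hq)
  simp only [mul_assoc, DAHA.tInv_mul_t, mul_one, smul_mul_assoc, smul_smul,
    inv_mul_cancel₀ hq, one_smul] at h
  exact h.symm

theorem DAHA.t_zero_mul_one (hq : q ≠ 0) :
    DAHA.tInv F q 3 * DAHA.tInv F q 2 = q • (DAHA.t F q 0 * DAHA.t F q 1) := by
  rw [← DAHA.tInv_mul_t_mul 3 (DAHA.t F q 0 * DAHA.t F q 1),
    DAHA.t_three_mul_zero_mul_one hq, mul_smul_comm, smul_smul, mul_inv_cancel₀ hq, one_smul]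

theorem DAHA.tInv_one_mul_zero_mul_three (hq : q ≠ 0) :
    DAHA.tInv F q 1 * (DAHA.tInv F q 0 * DAHA.tInv F q 3) = q • DAHA.t F q 2 := by
  rw [DAHA.tInv_one_eq hq]
  simp only [smul_mul_assoc, mul_assoc, DAHA.t_mul_tInv_mul, DAHA.t_mul_tInv, mul_one]

/-- Conjugation by `t_0` fixes `w_i` and exchanges the two orders of the factors. Both forms are
needed: the defining one handles `t_3 t_1`, this one `t_1 t_3`. -/
theorem DAHA.w_eq (i : Fin 4) :
    DAHA.w F q i = DAHA.t F q 0 * DAHA.t F q i + DAHA.tInv F q i * DAHA.tInv F q 0 := by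
  have h : DAHA.w F q i = DAHA.t F q 0 * DAHA.w F q i * DAHA.tInv F q 0 := by
    rw [DAHA.t_zero_comm, mul_assoc, DAHA.t_mul_tInv, mul_one]
  rw [h, DAHA.w]
  simp only [mul_add, add_mul, mul_assoc, DAHA.t_mul_tInv, DAHA.t_mul_tInv_mul, mul_one]

theorem DAHA.w_relation_aux {x y z : Fin 4} (a b c : Fin 4)
    (h : ((algebraMap F (Subalgebra.center F (DAHA F q)) q) ^ 2 -
          (algebraMap F (Subalgebra.center F (DAHA F q)) q⁻¹) ^ 2) • DAHA.w F q x +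
        (algebraMap F (Subalgebra.center F (DAHA F q)) q • (DAHA.w F q y * DAHA.w F q z) -
          algebraMap F (Subalgebra.center F (DAHA F q)) q⁻¹ • (DAHA.w F q z * DAHA.w F q y)) =
      (algebraMap F (Subalgebra.center F (DAHA F q)) q -
          algebraMap F (Subalgebra.center F (DAHA F q)) q⁻¹) •
        ((DAHA.c F q a * DAHA.c F q b) • (1 : DAHA F q) +
          DAHA.c F q c • (algebraMap F (Subalgebra.center F (DAHA F q)) q •
          DAHA.tInv F q 0 + algebraMap F (Subalgebra.center F (DAHA F q)) q⁻¹ • DAHA.t F q 0))) :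
    (q ^ 2 - q⁻¹ ^ 2) • DAHA.w F q x +
        (q • (DAHA.w F q y * DAHA.w F q z) - q⁻¹ • (DAHA.w F q z * DAHA.w F q y)) =
      (q - q⁻¹) • ((DAHA.t F q a + DAHA.tInv F q a) * (DAHA.t F q b + DAHA.tInv F q b) +
        (DAHA.t F q c + DAHA.tInv F q c) * (q • DAHA.tInv F q 0 + q⁻¹ • DAHA.t F q 0)) := by
  rw [← map_pow, ← map_pow, ← map_sub, ← map_sub] at h
  simpa only [algebraMap_smul, Subalgebra.smul_def, smul_eq_mul, mul_one, Subalgebra.coe_mul,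
    DAHA.c] using h

/-- Apart from central elements the right side involves only `t_0`. This is what allows `t_0` to be
recovered from the `w_i` on a module where `t_1 + t_1⁻¹` acts as a nonzero scalar. -/
theorem DAHA.w_relation_one (hq : NotRootOfUnity q) :
    (q ^ 2 - q⁻¹ ^ 2) • DAHA.w F q 1 +
        (q • (DAHA.w F q 3 * DAHA.w F q 2) - q⁻¹ • (DAHA.w F q 2 * DAHA.w F q 3)) =
      (q - q⁻¹) • ((DAHA.t F q 3 + DAHA.tInv F q 3) * (DAHA.t F q 2 + DAHA.tInv F q 2) +
        (DAHA.t F q 1 + DAHA.tInv F q 1) * (q • DAHA.tInv F q 0 + q⁻¹ • DAHA.t F q 0)) :=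
  DAHA.w_relation_aux 3 2 1 (zeta_aux_alpha _ _ _ _ _ _ _ _ _ _ _ _ _ _
    (center_inv_mul hq) (DAHA.t_sq 0) (DAHA.t_sq 2) (DAHA.t_sq 3)
    (DAHA.tInv_eq 0) (DAHA.tInv_eq 2) (DAHA.tInv_eq 3)
    DAHA.t_one_eq' (DAHA.tInv_one_eq' hq.1) DAHA.rel_one)

theorem DAHA.w_relation_three (hq : NotRootOfUnity q) :
    (q ^ 2 - q⁻¹ ^ 2) • DAHA.w F q 3 +
        (q • (DAHA.w F q 2 * DAHA.w F q 1) - q⁻¹ • (DAHA.w F q 1 * DAHA.w F q 2)) =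
      (q - q⁻¹) • ((DAHA.t F q 2 + DAHA.tInv F q 2) * (DAHA.t F q 1 + DAHA.tInv F q 1) +
        (DAHA.t F q 3 + DAHA.tInv F q 3) * (q • DAHA.tInv F q 0 + q⁻¹ • DAHA.t F q 0)) :=
  DAHA.w_relation_aux 2 1 3 (zeta_aux_beta _ _ _ _ _ _ _ _ _ _ _ _ _ _
    (center_inv_mul hq) (DAHA.t_sq 0) (DAHA.t_sq 2) (DAHA.t_sq 3)
    (DAHA.tInv_eq 0) (DAHA.tInv_eq 2) (DAHA.tInv_eq 3)
    DAHA.t_one_eq' (DAHA.tInv_one_eq' hq.1) DAHA.rel_one)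

theorem DAHA.w_relation_two (hq : NotRootOfUnity q) :
    (q ^ 2 - q⁻¹ ^ 2) • DAHA.w F q 2 +
        (q • (DAHA.w F q 1 * DAHA.w F q 3) - q⁻¹ • (DAHA.w F q 3 * DAHA.w F q 1)) =
      (q - q⁻¹) • ((DAHA.t F q 1 + DAHA.tInv F q 1) * (DAHA.t F q 3 + DAHA.tInv F q 3) +
        (DAHA.t F q 2 + DAHA.tInv F q 2) * (q • DAHA.tInv F q 0 + q⁻¹ • DAHA.t F q 0)) :=
  DAHA.w_relation_aux 1 3 2 (zeta_aux_gamma _ _ _ _ _ _ _ _ _ _ _ _ _ _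
    (center_inv_mul hq) (DAHA.t_sq 0) (DAHA.t_sq 2) (DAHA.t_sq 3)
    (DAHA.tInv_eq 0) (DAHA.tInv_eq 2) (DAHA.tInv_eq 3)
    DAHA.t_one_eq' (DAHA.tInv_one_eq' hq.1) DAHA.rel_one)

theorem DAHA.induction_on {P : DAHA F q → Prop} (x : DAHA F q)
    (algebraMap : ∀ r, P (algebraMap F (DAHA F q) r)) (t : ∀ i, P (DAHA.t F q i))
    (tInv : ∀ i, P (DAHA.tInv F q i)) (mul : ∀ x y, P x → P y → P (x * y))
    (add : ∀ x y, P x → P y → P (x + y)) : P x := by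
  obtain ⟨x, rfl⟩ := RingQuot.mkAlgHom_surjective F (DAHARel F q) x
  induction x using FreeAlgebra.induction with
  | grade0 r =>
    rw [AlgHom.commutes]
    exact algebraMap r
  | grade1 g =>
    cases g with
    | t i => exact t i
    | tInv i => exact tInv i
  | mul a b ha hb =>
    rw [map_mul]
    exact mul _ _ ha hb
  | add a b ha hb =>
    rw [map_add]
    exact add _ _ ha hb

end Relations

/-! ### The irreducibility criterion and submodules of an eigenspace of `t_0` -/

namespace OMod

section Action

variable {F : Type*} [Field F] {q : F} {d : ℕ} {k0 k1 k2 k3 : F}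
  {hq : NotRootOfUnity q} {hd : Even d} {hk0 : k0 ≠ 0} {hk1 : k1 ≠ 0} {hk2 : k2 ≠ 0}
  {hk3 : k3 ≠ 0} {hk : k0 * k1 * k2 * k3 = q ^ (-(d : ℤ) - 1)}

theorem tInv_smul (i : Fin 4) (y : OMod hq hd hk0 hk1 hk2 hk3 hk) :
    DAHA.tInv F q i • y =
      (![k0, k1, k2, k3] i + (![k0, k1, k2, k3] i)⁻¹) • y - DAHA.t F q i • y := by
  have h : actHom hq hd hk0 hk1 hk2 hk3 hk (DAHA.tInv F q i) =
      actGen q d k0 k1 k2 k3 (DAHAGen.tInv i) := by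
    rw [actHom, DAHA.tInv]
    erw [RingQuot.liftAlgHom_mkAlgHom_apply]
    rw [FreeAlgebra.lift_ι_apply]
  rw [smul_def, h, t_smul]
  rfl

theorem c_smul (i : Fin 4) (y : OMod hq hd hk0 hk1 hk2 hk3 hk) :
    (DAHA.t F q i + DAHA.tInv F q i) • y =
      (![k0, k1, k2, k3] i + (![k0, k1, k2, k3] i)⁻¹) • y := by
  rw [add_smul, tInv_smul, add_sub_cancel]

theorem t_smul_t_smul (i : Fin 4) (y : OMod hq hd hk0 hk1 hk2 hk3 hk) :
    DAHA.t F q i • DAHA.t F q i • y =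
      (![k0, k1, k2, k3] i + (![k0, k1, k2, k3] i)⁻¹) • DAHA.t F q i • y - y := by
  have h := c_smul i (DAHA.t F q i • y)
  rw [← h, add_smul, ← mul_smul (DAHA.tInv F q i), DAHA.tInv_mul_t, one_smul, add_sub_cancel_right]

theorem algebraMap_smul' (r : F) (y : OMod hq hd hk0 hk1 hk2 hk3 hk) :
    algebraMap F (DAHA F q) r • y = r • y := by
  rw [Algebra.algebraMap_eq_smul_one, smul_assoc, one_smul]

variable (hq hd hk0 hk1 hk2 hk3 hk) in
/-- The action of `t_0`, as a `△_q`-linear map. -/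
noncomputable def tZero : Module.End (AW F q) (OMod hq hd hk0 hk1 hk2 hk3 hk) where
  toFun y := DAHA.t F q 0 • y
  map_add' := smul_add _
  map_smul' a y := by
    rw [RingHom.id_apply, AW_smul_def, AW_smul_def, ← mul_smul, t_zero_comm_zeta, mul_smul]

variable (hq hd hk0 hk1 hk2 hk3 hk) in
/-- The action of `t_0 - θ`, as a `△_q`-linear map. -/
noncomputable def tZeroSub (θ : F) : Module.End (AW F q) (OMod hq hd hk0 hk1 hk2 hk3 hk) :=
  tZero hq hd hk0 hk1 hk2 hk3 hk - Module.toModuleEnd (AW F q) (S := F) _ θ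

theorem tZeroSub_apply (θ : F) (y : OMod hq hd hk0 hk1 hk2 hk3 hk) :
    tZeroSub hq hd hk0 hk1 hk2 hk3 hk θ y = DAHA.t F q 0 • y - θ • y := rfl

theorem smul_mem_of_field (W : Submodule (AW F q) (OMod hq hd hk0 hk1 hk2 hk3 hk)) (r : F)
    {x : OMod hq hd hk0 hk1 hk2 hk3 hk} (hx : x ∈ W) : r • x ∈ W :=
  (W.restrictScalars F).smul_mem r hx

theorem w_smul_mem (W : Submodule (AW F q) (OMod hq hd hk0 hk1 hk2 hk3 hk))
    {x : OMod hq hd hk0 hk1 hk2 hk3 hk} (hx : x ∈ W) (i : Fin 4) (hi : i ≠ 0) :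
    DAHA.w F q i • x ∈ W := by
  have h (g : AWGen) : zetaGen F q g • x ∈ W := by
    rw [← zeta_gen hq, ← AW_smul_def]
    exact W.smul_mem _ hx
  fin_cases i
  · exact absurd rfl hi
  · exact h AWGen.A
  -- The indices are crossed here: `C` maps to `w_2` and `B` to `w_3`.
  · exact h AWGen.C
  · exact h AWGen.B

/-- If a subspace stable under `t_0` and `△_q` contains `x`, `t_1 x`, `t_2 x`, `t_3 x`, it
contains all `t_i t_j x`. -/
theorem t_smul_t_smul_mem {W : Submodule (AW F q) (OMod hq hd hk0 hk1 hk2 hk3 hk)}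
    (hW : ∀ x ∈ W, DAHA.t F q 0 • x ∈ W) {x : OMod hq hd hk0 hk1 hk2 hk3 hk}
    (hx : x ∈ W) (h : ∀ i, DAHA.t F q i • x ∈ W) (i j : Fin 4) :
    DAHA.t F q i • DAHA.t F q j • x ∈ W := by
  have hs (r : F) {y : OMod hq hd hk0 hk1 hk2 hk3 hk} (hy : y ∈ W) : r • y ∈ W :=
    smul_mem_of_field W r hy
  have hI {i : Fin 4} {y : OMod hq hd hk0 hk1 hk2 hk3 hk} (hy : y ∈ W)
      (hty : DAHA.t F q i • y ∈ W) : DAHA.tInv F q i • y ∈ W := by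
    rw [tInv_smul]
    exact W.sub_mem (hs _ hy) hty
  have hI' {i : Fin 4} {y : OMod hq hd hk0 hk1 hk2 hk3 hk} (hy : y ∈ W)
      (hty : DAHA.tInv F q i • y ∈ W) : DAHA.t F q i • y ∈ W := by
    rw [tInv_smul] at hty
    exact (W.sub_mem_iff_right (hs _ hy)).1 hty
  have hW' (y : OMod hq hd hk0 hk1 hk2 hk3 hk) (hy : y ∈ W) : DAHA.tInv F q 0 • y ∈ W :=
    hI hy (hW y hy)
  have hinv (i : Fin 4) : DAHA.tInv F q i • x ∈ W := hI hx (h i)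
  -- products with `t_0` on the right
  have h0 (i : Fin 4) : DAHA.t F q i • DAHA.t F q 0 • x ∈ W := by
    by_cases hi : i = 0
    · subst hi
      exact hW _ (h 0)
    · have h1 := w_smul_mem W hx i hi
      rw [DAHA.w, add_smul, mul_smul, mul_smul] at h1
      exact (W.add_mem_iff_left (hW' _ (hinv i))).1 h1
  have h0' (i : Fin 4) : DAHA.tInv F q i • DAHA.tInv F q 0 • x ∈ W := by
    have h2 : DAHA.t F q i • DAHA.tInv F q 0 • x ∈ W := by
      rw [tInv_smul 0, smul_sub, smul_comm]
      exact W.sub_mem (hs _ (h i)) (h0 i)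
    exact hI (hinv 0) h2
  -- cancelling `tInv_j` in favour of `t_j`
  have hij {i j : Fin 4} (h2 : DAHA.t F q i • DAHA.tInv F q j • x ∈ W) :
      DAHA.t F q i • DAHA.t F q j • x ∈ W := by
    rw [tInv_smul j, smul_sub, smul_comm] at h2
    exact (W.sub_mem_iff_right (hs _ (h i))).1 h2
  have h11 (i : Fin 4) : DAHA.t F q i • DAHA.t F q i • x ∈ W := by
    rw [t_smul_t_smul]
    exact W.sub_mem (hs _ (h i)) hx
  have h12 : DAHA.t F q 1 • DAHA.t F q 2 • x ∈ W := by
    rw [← mul_smul, DAHA.t_one_mul_two, smul_assoc, mul_smul]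
    exact hs _ (hW' _ (hinv 3))
  have h23 : DAHA.t F q 2 • DAHA.t F q 3 • x ∈ W := by
    rw [← mul_smul, DAHA.t_two_mul_three, smul_assoc, mul_smul]
    exact hs _ (h0' 1)
  have h21 : DAHA.t F q 2 • DAHA.t F q 1 • x ∈ W := by
    refine hij (hI' (hinv 1) ?_)
    rw [← mul_smul, DAHA.tInv_two_mul_one hq.1, smul_assoc, mul_smul]
    exact hs _ (h0 3)
  have h32 : DAHA.t F q 3 • DAHA.t F q 2 • x ∈ W := by
    refine hij (hI' (hinv 2) ?_)
    rw [← mul_smul, DAHA.t_zero_mul_one hq.1, smul_assoc, mul_smul]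
    exact hs _ (hW _ (h 1))
  -- For the products of `t_1` and `t_3` a generator of `△_q` is applied to a vector already in `W`:
  -- in `w_3 t_1 x` the first summand `t_3 t_0 t_1 x` is `q⁻¹ t_2⁻¹ x`, so `t_0⁻¹ t_3⁻¹ t_1 x`
  -- remains.
  have h31 : DAHA.t F q 3 • DAHA.t F q 1 • x ∈ W := by
    have h1 := w_smul_mem W (h 1) 3 (by decide)
    rw [DAHA.w, add_smul, mul_smul, mul_smul, ← mul_smul (DAHA.t F q 0), ← mul_smul,
      DAHA.t_three_mul_zero_mul_one hq.1, smul_assoc,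
      W.add_mem_iff_right (hs _ (hinv 2))] at h1
    have h2 := hW _ h1
    rw [← mul_smul, DAHA.t_mul_tInv, one_smul] at h2
    exact hI' (h 1) h2
  -- Here `w_1` is applied to `t_3⁻¹ x`; the summand `t_1⁻¹ t_0⁻¹ t_3⁻¹ x` is `q t_2 x`, and `t_0
  -- t_1 t_3⁻¹ x` remains.
  have h13 : DAHA.t F q 1 • DAHA.t F q 3 • x ∈ W := by
    have h1 := w_smul_mem W (hinv 3) 1 (by decide)
    rw [DAHA.w_eq, add_smul, mul_smul, ← mul_smul (DAHA.tInv F q 1 * _), mul_assoc,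
      DAHA.tInv_one_mul_zero_mul_three hq.1, smul_assoc,
      W.add_mem_iff_left (hs _ (h 2))] at h1
    have h2 := hW' _ h1
    rw [← mul_smul, DAHA.tInv_mul_t, one_smul] at h2
    exact hij h2
  fin_cases i <;> fin_cases j
  · exact h0 0
  · exact hW _ (h 1)
  · exact hW _ (h 2)
  · exact hW _ (h 3)
  · exact h0 1
  · exact h11 1
  · exact h12
  · exact h13
  · exact h0 2
  · exact h21
  · exact h11 2
  · exact h23
  · exact h0 3
  · exact h31
  · exact h32
  · exact h11 3

/-- The vectors `x` of a `△_q`-submodule `W` stable under `t_0` such that all `t_i x` lie in `W`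
form an `𝔥_q`-submodule. -/
def core (W : Submodule (AW F q) (OMod hq hd hk0 hk1 hk2 hk3 hk))
    (hW : ∀ x ∈ W, DAHA.t F q 0 • x ∈ W) :
    Submodule (DAHA F q) (OMod hq hd hk0 hk1 hk2 hk3 hk) where
  carrier := {x | x ∈ W ∧ ∀ i, DAHA.t F q i • x ∈ W}
  add_mem' {x y} hx hy := ⟨W.add_mem hx.1 hy.1, fun i => by
    rw [smul_add]
    exact W.add_mem (hx.2 i) (hy.2 i)⟩
  zero_mem' := ⟨W.zero_mem, fun i => by
    rw [smul_zero]
    exact W.zero_mem⟩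
  smul_mem' a x hx := by
    have hF (r : F) {y : OMod hq hd hk0 hk1 hk2 hk3 hk}
        (hy : y ∈ W ∧ ∀ i, DAHA.t F q i • y ∈ W) :
        r • y ∈ W ∧ ∀ i, DAHA.t F q i • r • y ∈ W :=
      ⟨smul_mem_of_field W r hy.1, fun i => by
        rw [smul_comm]
        exact smul_mem_of_field W r (hy.2 i)⟩
    have ht {y : OMod hq hd hk0 hk1 hk2 hk3 hk} (j : Fin 4)
        (hy : y ∈ W ∧ ∀ i, DAHA.t F q i • y ∈ W) :
        DAHA.t F q j • y ∈ W ∧ ∀ i, DAHA.t F q i • DAHA.t F q j • y ∈ W :=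
      ⟨hy.2 j, fun i => t_smul_t_smul_mem hW hy.1 hy.2 i j⟩
    change a • x ∈ W ∧ ∀ i, DAHA.t F q i • a • x ∈ W
    replace hx : x ∈ W ∧ ∀ i, DAHA.t F q i • x ∈ W := hx
    induction a using DAHA.induction_on generalizing x with
    | algebraMap r =>
      rw [algebraMap_smul']
      exact hF r hx
    | t j => exact ht j hx
    | tInv j =>
      rw [tInv_smul]
      refine ⟨W.sub_mem (hF _ hx).1 (hx.2 j), fun i => ?_⟩
      rw [smul_sub]
      exact W.sub_mem ((hF _ hx).2 i) ((ht j hx).2 i)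
    | mul a b iha ihb =>
      rw [mul_smul]
      exact iha _ (ihb _ hx)
    | add a b iha ihb =>
      rw [add_smul]
      refine ⟨W.add_mem (iha _ hx).1 (ihb _ hx).1, fun i => ?_⟩
      rw [smul_add]
      exact W.add_mem ((iha _ hx).2 i) ((ihb _ hx).2 i)

/-- The vector `x` makes `core W hW` nonzero, hence everything by simplicity, and `core W hW` lies
in `W`. Irreducibility over `𝔥_q` enters the proof only through this criterion. -/
theorem eq_top_of_t_smul_mem
    (hirr : IsSimpleModule (DAHA F q) (OMod hq hd hk0 hk1 hk2 hk3 hk))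
    {W : Submodule (AW F q) (OMod hq hd hk0 hk1 hk2 hk3 hk)}
    (hW : ∀ x ∈ W, DAHA.t F q 0 • x ∈ W) {x : OMod hq hd hk0 hk1 hk2 hk3 hk} (hx0 : x ≠ 0)
    (hx : x ∈ W) (ht : ∀ i, i ≠ 0 → DAHA.t F q i • x ∈ W) : W = ⊤ := by
  have hmem : x ∈ core W hW := ⟨hx, fun i => by
    by_cases hi : i = 0
    · exact hi ▸ hW x hx
    · exact ht i hi⟩
  have htop : core W hW = ⊤ := (eq_bot_or_eq_top _).resolve_left fun h =>
    hx0 ((Submodule.mem_bot _).1 (h ▸ hmem))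
  refine eq_top_iff.2 fun y _ => ?_
  have hy : y ∈ core W hW := htop ▸ Submodule.mem_top
  exact hy.1

/-- `t_i` and `t_0` anticommute up to the action of `△_q` and lower terms. -/
theorem w_smul (i : Fin 4) (x : OMod hq hd hk0 hk1 hk2 hk3 hk) :
    DAHA.w F q i • x = DAHA.t F q i • DAHA.t F q 0 • x + DAHA.t F q 0 • DAHA.t F q i • x
      - (![k0, k1, k2, k3] i + (![k0, k1, k2, k3] i)⁻¹) • DAHA.t F q 0 • x
      - (k0 + k0⁻¹) • DAHA.t F q i • x
      + ((k0 + k0⁻¹) * (![k0, k1, k2, k3] i + (![k0, k1, k2, k3] i)⁻¹)) • x := by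
  rw [DAHA.w, add_smul, mul_smul, mul_smul, tInv_smul i, smul_sub, tInv_smul 0, tInv_smul 0,
    smul_comm (DAHA.t F q 0) (_ : F)]
  generalize DAHA.t F q i • DAHA.t F q 0 • x = a, DAHA.t F q 0 • DAHA.t F q i • x = b
  generalize DAHA.t F q 0 • x = u
  generalize DAHA.t F q i • x = v
  simp only [Matrix.cons_val_zero]
  module

theorem mem_eigenspace {θ : F} {x : OMod hq hd hk0 hk1 hk2 hk3 hk} :
    x ∈ eigenspace hq hd hk0 hk1 hk2 hk3 hk θ ↔ DAHA.t F q 0 • x = θ • x := Iff.rfl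

/-- A nonzero `△_q`-submodule of an eigenspace of `t_0` contains the image of `t_0 - θ'`, where
`θ` and `θ'` are the two eigenvalues. -/
theorem t_zero_sub_mem_of_le_eigenspace
    (hirr : IsSimpleModule (DAHA F q) (OMod hq hd hk0 hk1 hk2 hk3 hk)) {θ θ' : F}
    (hadd : θ + θ' = k0 + k0⁻¹)
    {W : Submodule (AW F q) (OMod hq hd hk0 hk1 hk2 hk3 hk)} (hW0 : W ≠ ⊥)
    (hW : W ≤ eigenspace hq hd hk0 hk1 hk2 hk3 hk θ) (y : OMod hq hd hk0 hk1 hk2 hk3 hk) :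
    DAHA.t F q 0 • y - θ' • y ∈ W := by
  obtain ⟨x, hxW, hx0⟩ := W.exists_mem_ne_zero_of_ne_bot hW0
  have hxe : DAHA.t F q 0 • x = θ • x := hW hxW
  -- The criterion is applied to the preimage of `W`, not to `W`. The preimage is `t_0`-stable
  -- because `t_0` acts on `W` as the scalar `θ`.
  have htop : W.comap (tZeroSub hq hd hk0 hk1 hk2 hk3 hk θ') = ⊤ := by
    refine eq_top_of_t_smul_mem hirr (fun z hz => ?_) hx0 ?_ fun i hi => ?_
    · rw [Submodule.mem_comap, tZeroSub_apply] at hz ⊢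
      have h1 : DAHA.t F q 0 • (DAHA.t F q 0 • z - θ' • z) = θ • (DAHA.t F q 0 • z - θ' • z) :=
        hW hz
      rw [← smul_comm (DAHA.t F q 0) θ', ← smul_sub, h1]
      exact smul_mem_of_field W θ hz
    · rw [Submodule.mem_comap, tZeroSub_apply, hxe, ← sub_smul]
      exact smul_mem_of_field W _ hxW
    · rw [Submodule.mem_comap, tZeroSub_apply]
      have h1 := w_smul_mem W hxW i hi
      rw [w_smul, hxe, smul_comm _ θ, ← hadd] at h1
      -- With `t_0 x = θ x` and `c_0 = θ + θ'`, the formula for `w_i x` collapses to `(t_0 - θ') t_i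
      -- x + θ' c_i x`.
      have h2 := W.sub_mem h1 (smul_mem_of_field W
        (θ' * (![k0, k1, k2, k3] i + (![k0, k1, k2, k3] i)⁻¹)) hxW)
      convert h2 using 1
      generalize DAHA.t F q 0 • DAHA.t F q i • x = b
      generalize DAHA.t F q i • x = v
      module
  exact (htop ▸ Submodule.mem_top : y ∈ W.comap (tZeroSub hq hd hk0 hk1 hk2 hk3 hk θ'))

end Action

end OMod

/-! ### Proper submodules when `k_0² = 1` -/

theorem NotRootOfUnity.sub_inv_ne_zero {F : Type*} [Field F] {q : F} (hq : NotRootOfUnity q) :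
    q - q⁻¹ ≠ 0 := fun h => hq.sq_sub_ne (by linear_combination (q + q⁻¹) * h)

namespace OMod

section Action

variable {F : Type*} [Field F] {q : F} {d : ℕ} {k0 k1 k2 k3 : F}
  {hq : NotRootOfUnity q} {hd : Even d} {hk0 : k0 ≠ 0} {hk1 : k1 ≠ 0} {hk2 : k2 ≠ 0}
  {hk3 : k3 ≠ 0} {hk : k0 * k1 * k2 * k3 = q ^ (-(d : ℤ) - 1)}

/-- If all three sums vanished, then `k_1² = k_2² = k_3² = -1`, so the fourth power of `k_0 k_1 k_2
k_3 = q^{-d-1}` would be `1`. -/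
theorem exists_add_inv_ne_zero (hq : NotRootOfUnity q) (hk1 : k1 ≠ 0) (hk2 : k2 ≠ 0)
    (hk3 : k3 ≠ 0) (hk : k0 * k1 * k2 * k3 = q ^ (-(d : ℤ) - 1)) (h : k0 ^ 2 = 1) :
    k1 + k1⁻¹ ≠ 0 ∨ k2 + k2⁻¹ ≠ 0 ∨ k3 + k3⁻¹ ≠ 0 := by
  by_contra! hc
  have hsq {k : F} (hk : k ≠ 0) (hc : k + k⁻¹ = 0) : k ^ 2 = -1 := by
    field_simp at hc
    linear_combination hc
  have h1 := hsq hk1 hc.1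
  have h2 := hsq hk2 hc.2.1
  have h3 := hsq hk3 hc.2.2
  have h4 : (q ^ (d + 1))⁻¹ ^ 4 = 1 := by
    rw [show -(d : ℤ) - 1 = -((d + 1 : ℕ) : ℤ) by push_cast; ring, zpow_neg, zpow_natCast] at hk
    rw [← hk, mul_pow, mul_pow, mul_pow, show 4 = 2 * 2 from rfl]
    simp only [pow_mul, h, h1, h2, h3]
    norm_num
  refine hq.2 ((d + 1) * 4) (by positivity) ?_
  rwa [inv_pow, inv_eq_one, ← pow_mul] at h4

/-- The left side of the relation preserves `W`. On the right, `q t_0⁻¹ + q⁻¹ t_0` acts as `q c_0 -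
(q - q⁻¹) t_0`, so `t_0 u` can be solved for after division by `c_x` and by `(q - q⁻¹)²`. -/
theorem t_zero_smul_mem_of_relation {W : Submodule (AW F q) (OMod hq hd hk0 hk1 hk2 hk3 hk)}
    {x y z : Fin 4} (hx : x ≠ 0) (hy : y ≠ 0) (hz : z ≠ 0)
    (hc : ![k0, k1, k2, k3] x + (![k0, k1, k2, k3] x)⁻¹ ≠ 0)
    (hrel : (q ^ 2 - q⁻¹ ^ 2) • DAHA.w F q x +
        (q • (DAHA.w F q y * DAHA.w F q z) - q⁻¹ • (DAHA.w F q z * DAHA.w F q y)) =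
      (q - q⁻¹) • ((DAHA.t F q y + DAHA.tInv F q y) * (DAHA.t F q z + DAHA.tInv F q z) +
        (DAHA.t F q x + DAHA.tInv F q x) * (q • DAHA.tInv F q 0 + q⁻¹ • DAHA.t F q 0)))
    {u : OMod hq hd hk0 hk1 hk2 hk3 hk} (hu : u ∈ W) : DAHA.t F q 0 • u ∈ W := by
  have hs (r : F) {y : OMod hq hd hk0 hk1 hk2 hk3 hk} (hy : y ∈ W) : r • y ∈ W :=
    smul_mem_of_field W r hy
  have hmem : ((q ^ 2 - q⁻¹ ^ 2) • DAHA.w F q x +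
      (q • (DAHA.w F q y * DAHA.w F q z) - q⁻¹ • (DAHA.w F q z * DAHA.w F q y))) • u ∈ W := by
    rw [add_smul, smul_assoc, sub_smul (q • _), smul_assoc, smul_assoc, mul_smul, mul_smul]
    exact W.add_mem (hs _ (w_smul_mem W hu x hx)) (W.sub_mem
      (hs _ (w_smul_mem W (w_smul_mem W hu z hz) y hy))
      (hs _ (w_smul_mem W (w_smul_mem W hu y hy) z hz)))
  rw [hrel, smul_assoc, add_smul, mul_smul, mul_smul, c_smul, c_smul, c_smul,
    add_smul (q • _), smul_assoc, smul_assoc, tInv_smul] at hmem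
  generalize ![k0, k1, k2, k3] x + (![k0, k1, k2, k3] x)⁻¹ = c at hmem hc
  generalize ![k0, k1, k2, k3] y + (![k0, k1, k2, k3] y)⁻¹ = c' at hmem
  generalize ![k0, k1, k2, k3] z + (![k0, k1, k2, k3] z)⁻¹ = c'' at hmem
  generalize ![k0, k1, k2, k3] 0 + (![k0, k1, k2, k3] 0)⁻¹ = e at hmem
  have hne := hq.sub_inv_ne_zero
  -- Subtracting the multiple of `u` leaves `-(q - q⁻¹) c (q - q⁻¹) t_0 u`; the scalar is the
  -- inverse of that coefficient.
  have h2 := hs (-(((q - q⁻¹) * c * (q - q⁻¹))⁻¹))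
    (W.sub_mem hmem (hs ((q - q⁻¹) * (c' * c'' + c * q * e)) hu))
  convert h2 using 1
  generalize DAHA.t F q 0 • u = w
  have h3 : (q - q⁻¹) • (c' • c'' • u + c • (q • (e • u - w) + q⁻¹ • w)) -
      ((q - q⁻¹) * (c' * c'' + c * q * e)) • u = (-((q - q⁻¹) * c * (q - q⁻¹))) • w := by
    module
  rw [h3, smul_smul, neg_mul_neg, inv_mul_cancel₀ (mul_ne_zero (mul_ne_zero hne hc) hne), one_smul]

theorem t_zero_smul_mem (h : k0 ^ 2 = 1)
    {W : Submodule (AW F q) (OMod hq hd hk0 hk1 hk2 hk3 hk)}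
    {u : OMod hq hd hk0 hk1 hk2 hk3 hk} (hu : u ∈ W) : DAHA.t F q 0 • u ∈ W := by
  rcases exists_add_inv_ne_zero hq hk1 hk2 hk3 hk h with hc | hc | hc
  · exact t_zero_smul_mem_of_relation (x := 1) (by decide) (by decide) (by decide) hc
      (DAHA.w_relation_one hq) hu
  · exact t_zero_smul_mem_of_relation (x := 2) (by decide) (by decide) (by decide) hc
      (DAHA.w_relation_two hq) hu
  · exact t_zero_smul_mem_of_relation (x := 3) (by decide) (by decide) (by decide) hc
      (DAHA.w_relation_three hq) hu

/-- The quadratic relation of `t_0` factors as `(t_0 - θ)(t_0 - θ') = 0`. -/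
theorem tZeroSub_mem_eigenspace {θ θ' : F} (hmul : θ * θ' = 1) (hadd : θ + θ' = k0 + k0⁻¹)
    (y : OMod hq hd hk0 hk1 hk2 hk3 hk) :
    tZeroSub hq hd hk0 hk1 hk2 hk3 hk θ' y ∈ eigenspace hq hd hk0 hk1 hk2 hk3 hk θ := by
  rw [mem_eigenspace, tZeroSub_apply, smul_sub, smul_comm _ θ', t_smul_t_smul,
    Matrix.cons_val_zero, ← hadd]
  generalize DAHA.t F q 0 • y = w
  have h1 : y = (θ * θ') • y := by rw [hmul, one_smul]
  nth_rw 1 [h1]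
  module

theorem inv_eq_self_of_sq_eq_one (h : k0 ^ 2 = 1) : k0⁻¹ = k0 :=
  inv_eq_of_mul_eq_one_right (by rwa [← sq])

/-- If `k_0² = 1`, every proper `△_q`-submodule consists of eigenvectors of `t_0`. -/
theorem le_eigenspace_of_ne_top
    (hirr : IsSimpleModule (DAHA F q) (OMod hq hd hk0 hk1 hk2 hk3 hk)) (h : k0 ^ 2 = 1)
    {W : Submodule (AW F q) (OMod hq hd hk0 hk1 hk2 hk3 hk)} (hW : W ≠ ⊤) :
    W ≤ eigenspace hq hd hk0 hk1 hk2 hk3 hk k0 := by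
  have hinv : k0⁻¹ = k0 := inv_eq_self_of_sq_eq_one h
  intro x hx
  by_contra hne
  have hs (r : F) {y : OMod hq hd hk0 hk1 hk2 hk3 hk} (hy : y ∈ W) : r • y ∈ W :=
    smul_mem_of_field W r hy
  have hu0 : tZeroSub hq hd hk0 hk1 hk2 hk3 hk k0 x ≠ 0 := fun h0 =>
    hne (mem_eigenspace.2 (sub_eq_zero.1 h0))
  have huE := tZeroSub_mem_eigenspace (hq := hq) (hd := hd) (hk1 := hk1) (hk2 := hk2)
    (hk3 := hk3) (hk := hk) (hk0 := hk0) (θ := k0) (θ' := k0) (by rwa [← sq]) (by rw [hinv]) x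
  have huW : tZeroSub hq hd hk0 hk1 hk2 hk3 hk k0 x ∈ W :=
    W.sub_mem (t_zero_smul_mem h hx) (hs _ hx)
  -- The nonzero vector `(t_0 - k_0) x` lies in `W` and in the eigenspace, so their intersection
  -- already contains the image of `t_0 - k_0`.
  have hN (y : OMod hq hd hk0 hk1 hk2 hk3 hk) : DAHA.t F q 0 • y - k0 • y ∈ W := by
    refine (t_zero_sub_mem_of_le_eigenspace hirr (W := W ⊓ eigenspace hq hd hk0 hk1 hk2 hk3 hk k0)
      (by rw [hinv]) (fun hbot => hu0 ?_) inf_le_right y).1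
    have hmem := Submodule.mem_inf.2 ⟨huW, huE⟩
    rwa [hbot, Submodule.mem_bot] at hmem
  -- The criterion is applied to `u = (t_0 - k_0) x`. Since `c_0 = 2 k_0`, the vector `w_i x` is
  -- `t_i u + (t_0 - k_0) t_i x` up to multiples of `x` and `t_0 x`; all terms but `t_i u` are known
  -- to lie in `W`.
  refine hW (eq_top_of_t_smul_mem hirr (fun y hy => t_zero_smul_mem h hy) hu0 huW fun i hi => ?_)
  have h1 := w_smul_mem W hx i hi
  rw [w_smul, hinv] at h1
  have h2 := W.sub_mem (W.sub_mem (W.add_mem h1 (hs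
    (![k0, k1, k2, k3] i + (![k0, k1, k2, k3] i)⁻¹) (t_zero_smul_mem h hx)))
    (hs ((k0 + k0) * (![k0, k1, k2, k3] i + (![k0, k1, k2, k3] i)⁻¹)) hx))
    (hN (DAHA.t F q i • x))
  rw [tZeroSub_apply, smul_sub, smul_comm _ k0]
  convert h2 using 1
  generalize DAHA.t F q i • DAHA.t F q 0 • x = a, DAHA.t F q 0 • DAHA.t F q i • x = b
  generalize DAHA.t F q 0 • x = u
  generalize DAHA.t F q i • x = v
  module

end Action

/-! ### The rank of `t_0 - k_0` -/

section Dimension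

variable {F : Type*} [Field F] {q : F} {d : ℕ} {k0 k1 k2 k3 : F}
  (hq : NotRootOfUnity q) (hd : Even d) (hk0 : k0 ≠ 0) (hk1 : k1 ≠ 0) (hk2 : k2 ≠ 0)
  (hk3 : k3 ≠ 0) (hk : k0 * k1 * k2 * k3 = q ^ (-(d : ℤ) - 1))

instance : FiniteDimensional F (OMod hq hd hk0 hk1 hk2 hk3 hk) :=
  inferInstanceAs (FiniteDimensional F (Fin (d + 1) → F))

theorem finrank_eq : Module.finrank F (OMod hq hd hk0 hk1 hk2 hk3 hk) = d + 1 :=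
  Module.finrank_fin_fun F

theorem span_v : Submodule.span F (Set.range (v hq hd hk0 hk1 hk2 hk3 hk)) = ⊤ := by
  refine eq_top_iff.2 (le_trans (Pi.basisFun F (Fin (d + 1))).span_eq.ge
    (Submodule.span_mono ?_))
  rintro _ ⟨i, rfl⟩
  refine ⟨i, ?_⟩
  rw [v, vec, dif_pos i.2, Pi.basisFun_apply]

theorem v_of_lt {i : ℕ} (h : d < i) : v hq hd hk0 hk1 hk2 hk3 hk i = 0 := vec_of_lt h

theorem tZeroSub_v_zero :
    tZeroSub hq hd hk0 hk1 hk2 hk3 hk k0 (v hq hd hk0 hk1 hk2 hk3 hk (2 * 0)) = 0 := by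
  rw [tZeroSub_apply, t_smul]
  exact sub_eq_zero.2 (act0_even_zero hd)

theorem tZeroSub_v_odd (m : ℕ) :
    tZeroSub hq hd hk0 hk1 hk2 hk3 hk k0 (v hq hd hk0 hk1 hk2 hk3 hk (2 * m + 1)) =
      (k0⁻¹ * ((q ^ (2 * m))⁻¹ * (q ^ 2)⁻¹)) • (v hq hd hk0 hk1 hk2 hk3 hk (2 * m + 1) -
        v hq hd hk0 hk1 hk2 hk3 hk (2 * (m + 1))) -
      k0 • v hq hd hk0 hk1 hk2 hk3 hk (2 * m + 1) := by
  have h : DAHA.t F q 0 • v hq hd hk0 hk1 hk2 hk3 hk (2 * m + 1) =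
      (k0⁻¹ * ((q ^ (2 * m))⁻¹ * (q ^ 2)⁻¹)) • (v hq hd hk0 hk1 hk2 hk3 hk (2 * m + 1) -
        v hq hd hk0 hk1 hk2 hk3 hk (2 * (m + 1))) := by
    rw [t_smul]
    exact act0_odd hq.1 hd m
  rw [tZeroSub_apply, h]

/-- The operator `t_0` is block diagonal, with blocks `v_0` and `v_{2m+1}, v_{2m+2}`. On each block
of size two `t_0 - k_0` has rank one, which is the proportionality stated here, so its image is
spanned by the images of the odd basis vectors. -/
theorem tZeroSub_v_even_succ (m : ℕ) :
    tZeroSub hq hd hk0 hk1 hk2 hk3 hk k0 (v hq hd hk0 hk1 hk2 hk3 hk (2 * (m + 1))) =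
      (1 - q ^ (2 * m) * q ^ 2) •
        tZeroSub hq hd hk0 hk1 hk2 hk3 hk k0 (v hq hd hk0 hk1 hk2 hk3 hk (2 * m + 1)) := by
  have h : DAHA.t F q 0 • v hq hd hk0 hk1 hk2 hk3 hk (2 * (m + 1)) =
      (k0⁻¹ * ((q ^ (2 * m))⁻¹ * (q ^ 2)⁻¹) * (1 - q ^ (2 * m) * q ^ 2) *
        (1 - k0 ^ 2 * (q ^ (2 * m) * q ^ 2))) • v hq hd hk0 hk1 hk2 hk3 hk (2 * m + 1)
      + (k0 + k0⁻¹ - k0⁻¹ * ((q ^ (2 * m))⁻¹ * (q ^ 2)⁻¹)) •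
        v hq hd hk0 hk1 hk2 hk3 hk (2 * (m + 1)) := by
    rw [t_smul]
    exact act0_even_succ hq.1 hd m
  rw [tZeroSub_v_odd, tZeroSub_apply, h]
  have hq0 := hq.1
  have hx : q ^ (2 * m) ≠ 0 := pow_ne_zero _ hq0
  generalize q ^ (2 * m) = x at hx ⊢
  match_scalars <;> field_simp <;> ring

theorem range_tZeroSub :
    (LinearMap.range (tZeroSub hq hd hk0 hk1 hk2 hk3 hk k0)).restrictScalars F =
      Submodule.span F (Set.range fun m : Fin (d / 2) =>
        tZeroSub hq hd hk0 hk1 hk2 hk3 hk k0 (v hq hd hk0 hk1 hk2 hk3 hk (2 * m + 1))) := by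
  refine le_antisymm ?_ (Submodule.span_le.2 ?_)
  · set S := Submodule.span F (Set.range fun m : Fin (d / 2) =>
        tZeroSub hq hd hk0 hk1 hk2 hk3 hk k0 (v hq hd hk0 hk1 hk2 hk3 hk (2 * m + 1))) with hS
    have hodd (m : ℕ) :
        tZeroSub hq hd hk0 hk1 hk2 hk3 hk k0 (v hq hd hk0 hk1 hk2 hk3 hk (2 * m + 1)) ∈ S := by
      by_cases hm : m < d / 2
      · exact Submodule.subset_span ⟨⟨m, hm⟩, rfl⟩
      · have := Nat.two_mul_div_two_of_even hd
        rw [v_of_lt hq hd hk0 hk1 hk2 hk3 hk (by omega), map_zero]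
        exact S.zero_mem
    have htop : (⊤ : Submodule F _) ≤
        S.comap ((tZeroSub hq hd hk0 hk1 hk2 hk3 hk k0).restrictScalars F) := by
      rw [← span_v hq hd hk0 hk1 hk2 hk3 hk, Submodule.span_le]
      rintro _ ⟨i, rfl⟩
      change tZeroSub hq hd hk0 hk1 hk2 hk3 hk k0 (v hq hd hk0 hk1 hk2 hk3 hk i) ∈ S
      rcases Nat.even_or_odd' i with ⟨m, rfl | rfl⟩
      · cases m with
        | zero =>
          rw [tZeroSub_v_zero]
          exact S.zero_mem
        | succ m =>
          rw [tZeroSub_v_even_succ]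
          exact S.smul_mem _ (hodd m)
      · exact hodd m
    rintro _ ⟨y, rfl⟩
    exact htop Submodule.mem_top
  · rintro _ ⟨m, rfl⟩
    exact ⟨_, rfl⟩

theorem linearIndependent_tZeroSub_v : LinearIndependent F fun m : Fin (d / 2) =>
    tZeroSub hq hd hk0 hk1 hk2 hk3 hk k0 (v hq hd hk0 hk1 hk2 hk3 hk (2 * m + 1)) := by
  -- Only the coordinates at `v_2, v_4, …, v_d` are kept. There the images become nonzero multiples
  -- of the standard basis vectors.
  let g : OMod hq hd hk0 hk1 hk2 hk3 hk →ₗ[F] (Fin (d / 2) → F) :=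
    LinearMap.funLeft F F fun m : Fin (d / 2) => (⟨2 * (m + 1), by omega⟩ : Fin (d + 1))
  have hvec (i : ℕ) (j : Fin (d + 1)) : vec F d i j = if (j : ℕ) = i then 1 else 0 := by
    rw [vec]
    split_ifs with h1 h2 h2
    · subst h2
      exact Pi.single_eq_same _ _
    · exact Pi.single_eq_of_ne (fun h => h2 (congrArg Fin.val h)) _
    · omega
    · rfl
  have hgodd (m : ℕ) : g (v hq hd hk0 hk1 hk2 hk3 hk (2 * m + 1)) = 0 := by
    funext j
    exact (hvec _ _).trans (if_neg (by simp only; omega))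
  have hgeven (m : Fin (d / 2)) :
      g (v hq hd hk0 hk1 hk2 hk3 hk (2 * (m + 1))) = Pi.single m 1 := by
    funext j
    refine (hvec _ _).trans ?_
    by_cases h : j = m
    · subst h
      rw [if_pos rfl, Pi.single_eq_same]
    · rw [Pi.single_eq_of_ne h, if_neg]
      have := Fin.val_ne_of_ne h
      simp only
      omega
  refine LinearIndependent.of_comp g ?_
  let r (m : Fin (d / 2)) : Fˣ :=
    Units.mk0 (-(k0⁻¹ * ((q ^ (2 * (m : ℕ)))⁻¹ * (q ^ 2)⁻¹))) (neg_ne_zero.2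
      (mul_ne_zero (inv_ne_zero hk0) (mul_ne_zero (inv_ne_zero (pow_ne_zero _ hq.1))
        (inv_ne_zero (pow_ne_zero _ hq.1)))))
  convert (Pi.basisFun F (Fin (d / 2))).linearIndependent.units_smul r using 1
  funext m
  rw [Function.comp_apply, tZeroSub_v_odd, map_sub, map_smul, map_smul, map_sub, hgodd, hgeven,
    Pi.smul_apply', Pi.basisFun_apply, Units.smul_def, Units.val_mk0]
  module

theorem finrank_range_tZeroSub :
    Module.finrank F (LinearMap.range (tZeroSub hq hd hk0 hk1 hk2 hk3 hk k0)) = d / 2 := by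
  change Module.finrank F
    ((LinearMap.range (tZeroSub hq hd hk0 hk1 hk2 hk3 hk k0)).restrictScalars F) = d / 2
  rw [range_tZeroSub, finrank_span_eq_card (linearIndependent_tZeroSub_v ..), Fintype.card_fin]

theorem finrank_eigenspace :
    Module.finrank F (eigenspace hq hd hk0 hk1 hk2 hk3 hk k0) = d / 2 + 1 := by
  let f := (tZeroSub hq hd hk0 hk1 hk2 hk3 hk k0).restrictScalars F
  have h1 : Module.finrank F (LinearMap.range f) = d / 2 :=
    finrank_range_tZeroSub hq hd hk0 hk1 hk2 hk3 hk
  have h2 : (eigenspace hq hd hk0 hk1 hk2 hk3 hk k0).restrictScalars F = LinearMap.ker f := by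
    ext x
    exact sub_eq_zero.symm
  have h3 := f.finrank_range_add_finrank_ker
  rw [h1, finrank_eq, ← h2] at h3
  change Module.finrank F ((eigenspace hq hd hk0 hk1 hk2 hk3 hk k0).restrictScalars F) = _
  have := Nat.two_mul_div_two_of_even hd
  omega

/-- As `k_0⁻¹ = k_0`, the image of `v_{i-1}` (`i` even) under `t_0 - k_0` is `-k_0` times the
spanning vector with index `i`. This exhibits `O(k_0)'` as the image of a `△_q`-linear map, hence as
a `△_q`-submodule. -/
theorem range_tZeroSub_eq_eigenspace' (h : k0 ^ 2 = 1) :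
    (LinearMap.range (tZeroSub hq hd hk0 hk1 hk2 hk3 hk k0)).restrictScalars F =
      eigenspace' hq hd hk0 hk1 hk2 hk3 hk := by
  have hinv : k0⁻¹ = k0 := inv_eq_self_of_sq_eq_one h
  have hv (m : ℕ) : tZeroSub hq hd hk0 hk1 hk2 hk3 hk k0 (v hq hd hk0 hk1 hk2 hk3 hk (2 * m + 1)) =
      (-k0) • (v hq hd hk0 hk1 hk2 hk3 hk (2 * (m + 1) - 1) + q ^ (-((2 * (m + 1) : ℕ) : ℤ)) •
        (v hq hd hk0 hk1 hk2 hk3 hk (2 * (m + 1)) -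
          v hq hd hk0 hk1 hk2 hk3 hk (2 * (m + 1) - 1))) := by
    rw [tZeroSub_v_odd, hinv, zpow_neg, zpow_natCast, mul_add 2 m 1, mul_one, pow_add, mul_inv]
    change _ = (-k0) • (v hq hd hk0 hk1 hk2 hk3 hk (2 * m + 1) + _ •
      (_ - v hq hd hk0 hk1 hk2 hk3 hk (2 * m + 1)))
    module
  rw [range_tZeroSub]
  refine le_antisymm (Submodule.span_le.2 ?_) (Submodule.span_le.2 ?_)
  · rintro _ ⟨m, rfl⟩
    simp only [hv]
    exact Submodule.smul_mem _ _ (Submodule.subset_span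
      ⟨2 * (m + 1), by omega, by omega, even_two_mul _, rfl⟩)
  · rintro _ ⟨i, hi2, hid, hi, rfl⟩
    obtain ⟨m, rfl⟩ : ∃ m, i = 2 * (m + 1) := by
      obtain ⟨n, rfl⟩ := hi
      exact ⟨n - 1, by omega⟩
    rw [SetLike.mem_coe, ← Submodule.smul_mem_iff _ (neg_ne_zero.2 hk0), ← hv]
    exact Submodule.subset_span ⟨⟨m, by omega⟩, rfl⟩

end Dimension

end OMod

/-! ### Lattice and dimension arguments, and the decomposition when `k_0² ≠ 1` -/

/-- In a modular lattice, an element other than `⊥`, two complementary atoms and `⊤` is a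
complement of both atoms. -/
theorem eq_or_isCompl_of_isAtom {α : Type*} [Lattice α] [BoundedOrder α] [IsModularLattice α]
    {a b : α} (ha : IsAtom a) (hb : IsAtom b) (hab : IsCompl a b) (c : α) :
    c = ⊥ ∨ c = a ∨ c = b ∨ c = ⊤ ∨ IsCompl c a ∧ IsCompl c b := by
  have ha' : IsCoatom a := hab.symm.isAtom_iff_isCoatom.1 hb
  have hb' : IsCoatom b := hab.isAtom_iff_isCoatom.1 ha
  by_cases hac : a ≤ c
  · rcases ha'.le_iff.1 hac with h | h <;> simp [h]
  by_cases hbc : b ≤ c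
  · rcases hb'.le_iff.1 hbc with h | h <;> simp [h]
  have hda := (ha.not_le_iff_disjoint.1 hac).symm
  have hdb := (hb.not_le_iff_disjoint.1 hbc).symm
  by_cases hca : c ≤ a
  · exact Or.inl (hda.eq_bot_of_le hca)
  by_cases hcb : c ≤ b
  · exact Or.inl (hdb.eq_bot_of_le hcb)
  exact Or.inr (Or.inr (Or.inr (Or.inr
    ⟨⟨hda, (ha'.not_le_iff_codisjoint.1 hca).symm⟩, hdb, (hb'.not_le_iff_codisjoint.1 hcb).symm⟩)))

theorem finrank_add_eq_of_isCompl_of_tower {K A V : Type*} [Field K] [Ring A] [Algebra K A]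
    [AddCommGroup V] [Module K V] [Module A V] [IsScalarTower K A V] [FiniteDimensional K V]
    {U W : Submodule A V} (h : IsCompl U W) :
    Module.finrank K U + Module.finrank K W = Module.finrank K V :=
  Submodule.finrank_add_eq_of_isCompl (U := U.restrictScalars K) (W := W.restrictScalars K)
    ((Submodule.isCompl_restrictScalars_iff K).2 h)

theorem eq_of_le_of_finrank_le_of_tower {K A V : Type*} [Field K] [Ring A] [Algebra K A]
    [AddCommGroup V] [Module K V] [Module A V] [IsScalarTower K A V] [FiniteDimensional K V]
    {U W : Submodule A V} (h : U ≤ W) (hf : Module.finrank K W ≤ Module.finrank K U) : U = W :=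
  Submodule.restrictScalars_injective K A V
    (Submodule.eq_of_le_of_finrank_le (S₁ := U.restrictScalars K) (S₂ := W.restrictScalars K) h hf)

namespace OMod

section Lattice

variable {F : Type*} [Field F] {q : F} {d : ℕ} {k0 k1 k2 k3 : F}
  {hq : NotRootOfUnity q} {hd : Even d} {hk0 : k0 ≠ 0} {hk1 : k1 ≠ 0} {hk2 : k2 ≠ 0}
  {hk3 : k3 ≠ 0} {hk : k0 * k1 * k2 * k3 = q ^ (-(d : ℤ) - 1)}

/-- On the `θ`-eigenspace `t_0 - θ'` is multiplication by the nonzero scalar `θ - θ'`. -/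
theorem eigenspace_eq_range {θ θ' : F} (hmul : θ * θ' = 1) (hadd : θ + θ' = k0 + k0⁻¹)
    (hne : θ ≠ θ') : eigenspace hq hd hk0 hk1 hk2 hk3 hk θ =
      LinearMap.range (tZeroSub hq hd hk0 hk1 hk2 hk3 hk θ') := by
  apply le_antisymm
  · intro x hx
    refine ⟨(θ - θ')⁻¹ • x, ?_⟩
    rw [tZeroSub_apply, smul_comm _ (θ - θ')⁻¹, mem_eigenspace.1 hx, smul_comm θ', ← smul_sub,
      ← sub_smul, smul_smul, inv_mul_cancel₀ (sub_ne_zero.2 hne), one_smul]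
  · rintro _ ⟨y, rfl⟩
    exact tZeroSub_mem_eigenspace hmul hadd y

theorem isCompl_eigenspace {θ θ' : F} (hmul : θ * θ' = 1) (hadd : θ + θ' = k0 + k0⁻¹)
    (hne : θ ≠ θ') : IsCompl (eigenspace hq hd hk0 hk1 hk2 hk3 hk θ)
      (eigenspace hq hd hk0 hk1 hk2 hk3 hk θ') := by
  have hne' := sub_ne_zero.2 hne
  refine ⟨Submodule.disjoint_def.2 fun x hx hx' => ?_, ?_⟩
  · rw [mem_eigenspace] at hx hx'
    rw [hx, ← sub_eq_zero, ← sub_smul] at hx'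
    exact (smul_eq_zero.1 hx').resolve_left hne'
  · rw [codisjoint_iff, eq_top_iff]
    rintro x -
    -- The decomposition of `x` comes from `(θ - θ') x = (t_0 - θ') x - (t_0 - θ) x`.
    have h1 := tZeroSub_mem_eigenspace (hq := hq) (hd := hd) (hk1 := hk1) (hk2 := hk2)
      (hk3 := hk3) (hk := hk) (hk0 := hk0) hmul hadd ((θ - θ')⁻¹ • x)
    have h2 := tZeroSub_mem_eigenspace (hq := hq) (hd := hd) (hk1 := hk1) (hk2 := hk2)
      (hk3 := hk3) (hk := hk) (hk0 := hk0) (by rwa [mul_comm]) (by rwa [add_comm])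
      (-((θ - θ')⁻¹ • x))
    convert Submodule.add_mem_sup h1 h2 using 1
    rw [tZeroSub_apply, tZeroSub_apply, smul_neg]
    generalize DAHA.t F q 0 • (θ - θ')⁻¹ • x = y
    have h3 : x = ((θ - θ') * (θ - θ')⁻¹) • x := by rw [mul_inv_cancel₀ hne', one_smul]
    nth_rw 1 [h3]
    module

/-- A nonzero submodule of the eigenspace contains the image of `t_0 - θ'`, which is the whole
eigenspace because `θ ≠ θ'`. -/
theorem isAtom_eigenspace
    (hirr : IsSimpleModule (DAHA F q) (OMod hq hd hk0 hk1 hk2 hk3 hk)) {θ θ' : F}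
    (hmul : θ * θ' = 1) (hadd : θ + θ' = k0 + k0⁻¹) (hne : θ ≠ θ')
    (hbot : eigenspace hq hd hk0 hk1 hk2 hk3 hk θ ≠ ⊥) :
    IsAtom (eigenspace hq hd hk0 hk1 hk2 hk3 hk θ) := by
  refine ⟨hbot, fun W hW => ?_⟩
  by_contra hW0
  refine hW.not_ge ?_
  rw [eigenspace_eq_range hmul hadd hne]
  rintro _ ⟨y, rfl⟩
  exact t_zero_sub_mem_of_le_eigenspace hirr hadd hW0 hW.le y

end Lattice

end OMod

end AskeyWilson

/-! ### The three cases of the theorem -/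

theorem mainTheorem8 {F : Type*} [Field F] [IsAlgClosed F] {q : F} (hq : NotRootOfUnity q)
    {d : ℕ} (hd : Even d) {k0 k1 k2 k3 : F}
    (hk0 : k0 ≠ 0) (hk1 : k1 ≠ 0) (hk2 : k2 ≠ 0) (hk3 : k3 ≠ 0)
    (hk : k0 * k1 * k2 * k3 = q ^ (-(d : ℤ) - 1))
    (hirr : IsSimpleModule (DAHA F q) (OMod hq hd hk0 hk1 hk2 hk3 hk)) :
    (d = 0 → IsSimpleModule (AW F q) (OMod hq hd hk0 hk1 hk2 hk3 hk)) ∧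
    (2 ≤ d → k0 ^ 2 = 1 →
      ∃ E' : Submodule (AW F q) (OMod hq hd hk0 hk1 hk2 hk3 hk),
        E'.restrictScalars F = OMod.eigenspace' hq hd hk0 hk1 hk2 hk3 hk ∧
        ⊥ < E' ∧ E' < OMod.eigenspace hq hd hk0 hk1 hk2 hk3 hk k0 ∧
        OMod.eigenspace hq hd hk0 hk1 hk2 hk3 hk k0 < ⊤ ∧
        Module.finrank F E' + 1 =
          Module.finrank F (OMod.eigenspace hq hd hk0 hk1 hk2 hk3 hk k0) ∧
        ∀ W : Submodule (AW F q) (OMod hq hd hk0 hk1 hk2 hk3 hk),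
          W = ⊥ ∨ W = E' ∨ W = OMod.eigenspace hq hd hk0 hk1 hk2 hk3 hk k0 ∨ W = ⊤) ∧
    (2 ≤ d → k0 ^ 2 ≠ 1 →
      ⊥ < OMod.eigenspace hq hd hk0 hk1 hk2 hk3 hk k0 ∧
      OMod.eigenspace hq hd hk0 hk1 hk2 hk3 hk k0 < ⊤ ∧
      ⊥ < OMod.eigenspace hq hd hk0 hk1 hk2 hk3 hk k0⁻¹ ∧
      OMod.eigenspace hq hd hk0 hk1 hk2 hk3 hk k0⁻¹ < ⊤ ∧
      IsCompl (OMod.eigenspace hq hd hk0 hk1 hk2 hk3 hk k0)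
        (OMod.eigenspace hq hd hk0 hk1 hk2 hk3 hk k0⁻¹) ∧
      ∀ W : Submodule (AW F q) (OMod hq hd hk0 hk1 hk2 hk3 hk),
        W = ⊥ ∨ W = OMod.eigenspace hq hd hk0 hk1 hk2 hk3 hk k0 ∨
          W = OMod.eigenspace hq hd hk0 hk1 hk2 hk3 hk k0⁻¹ ∨ W = ⊤) := by
  have hrank := OMod.finrank_eq hq hd hk0 hk1 hk2 hk3 hk
  have hE := OMod.finrank_eigenspace hq hd hk0 hk1 hk2 hk3 hk
  have hR := OMod.finrank_range_tZeroSub hq hd hk0 hk1 hk2 hk3 hk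
  have hd2 := Nat.two_mul_div_two_of_even hd
  have hne_bot {W : Submodule (AW F q) (OMod hq hd hk0 hk1 hk2 hk3 hk)}
      (h : 0 < Module.finrank F W) : W ≠ ⊥ := by
    rintro rfl
    exact h.ne' (finrank_bot F (OMod hq hd hk0 hk1 hk2 hk3 hk))
  have hne_top {W : Submodule (AW F q) (OMod hq hd hk0 hk1 hk2 hk3 hk)}
      (h : Module.finrank F W < d + 1) : W ≠ ⊤ := by
    rintro rfl
    exact h.ne ((finrank_top F (OMod hq hd hk0 hk1 hk2 hk3 hk)).trans hrank)
  refine ⟨fun h0 => ?_, fun h2 hk0' => ?_, fun h2 hk0' => ?_⟩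
  -- For `d = 0` the module is one-dimensional.
  · have := is_simple_module_of_finrank_eq_one (A := AW F q) (hrank.trans (by omega))
    exact (isSimpleModule_iff ..).2 this
  · have hinv := OMod.inv_eq_self_of_sq_eq_one hk0'
    have hle : LinearMap.range (OMod.tZeroSub hq hd hk0 hk1 hk2 hk3 hk k0) ≤
        OMod.eigenspace hq hd hk0 hk1 hk2 hk3 hk k0 := by
      rintro _ ⟨y, rfl⟩
      exact OMod.tZeroSub_mem_eigenspace (by rwa [← sq]) (by rw [hinv]) y
    refine ⟨_, OMod.range_tZeroSub_eq_eigenspace' hq hd hk0 hk1 hk2 hk3 hk hk0',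
      bot_lt_iff_ne_bot.2 (hne_bot (by omega)), hle.lt_of_ne fun h => ?_,
      lt_top_iff_ne_top.2 (hne_top (by omega)), by omega, fun W => ?_⟩
    · rw [h] at hR
      omega
    · by_cases hbot : W = ⊥
      · exact Or.inl hbot
      by_cases htop : W = ⊤
      · exact Or.inr (Or.inr (Or.inr htop))
      have hWE := OMod.le_eigenspace_of_ne_top hirr hk0' htop
      have hRW : LinearMap.range (OMod.tZeroSub hq hd hk0 hk1 hk2 hk3 hk k0) ≤ W := by
        rintro _ ⟨y, rfl⟩
        exact OMod.t_zero_sub_mem_of_le_eigenspace hirr (by rw [hinv]) hbot hWE y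
      -- `W` lies between the image and the kernel of `t_0 - k_0`, of dimensions `d/2` and `d/2 +
      -- 1`, so its dimension decides which of the two it equals.
      rcases Nat.lt_or_ge (d / 2) (Module.finrank F W) with h | h
      · exact Or.inr (Or.inr (Or.inl
          (eq_of_le_of_finrank_le_of_tower (K := F) hWE (by omega))))
      · exact Or.inr (Or.inl (eq_of_le_of_finrank_le_of_tower (K := F) hRW (by omega)).symm)
  · have hmul : k0 * k0⁻¹ = 1 := mul_inv_cancel₀ hk0
    have hmul' : k0⁻¹ * k0 = 1 := inv_mul_cancel₀ hk0
    have hadd' : k0⁻¹ + k0 = k0 + k0⁻¹ := add_comm _ _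
    have hne : k0 ≠ k0⁻¹ := fun h => hk0' (by rwa [sq, mul_eq_one_iff_eq_inv₀ hk0])
    have hE' : Module.finrank F (OMod.eigenspace hq hd hk0 hk1 hk2 hk3 hk k0⁻¹) = d / 2 := by
      rw [OMod.eigenspace_eq_range hmul' hadd' hne.symm, hR]
    have hb := hne_bot (W := OMod.eigenspace hq hd hk0 hk1 hk2 hk3 hk k0) (by omega)
    have hb' := hne_bot (W := OMod.eigenspace hq hd hk0 hk1 hk2 hk3 hk k0⁻¹) (by omega)
    have hc : IsCompl (OMod.eigenspace hq hd hk0 hk1 hk2 hk3 hk k0)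
        (OMod.eigenspace hq hd hk0 hk1 hk2 hk3 hk k0⁻¹) := OMod.isCompl_eigenspace hmul rfl hne
    refine ⟨bot_lt_iff_ne_bot.2 hb, lt_top_iff_ne_top.2 (hne_top (by omega)),
      bot_lt_iff_ne_bot.2 hb', lt_top_iff_ne_top.2 (hne_top (by omega)), hc, fun W => ?_⟩
    rcases eq_or_isCompl_of_isAtom (OMod.isAtom_eigenspace hirr hmul rfl hne hb)
      (OMod.isAtom_eigenspace hirr hmul' hadd' hne.symm hb') hc W with h | h | h | h | ⟨h, h'⟩
    · exact Or.inl h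
    · exact Or.inr (Or.inl h)
    · exact Or.inr (Or.inr (Or.inl h))
    · exact Or.inr (Or.inr (Or.inr h))
    -- A common complement would force the two eigenspaces to have equal dimension, but these are
    -- `d/2 + 1` and `d/2`.
    · have h3 := finrank_add_eq_of_isCompl_of_tower (K := F) h
      have h4 := finrank_add_eq_of_isCompl_of_tower (K := F) h'
      omega
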